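/- All logarithms are to base 2 unless written $\ln$. A function $\mathrm{Ext}:\{0,1\}^n\times\{0,1\}^d\to\{0,1\}^m$ is a $(k,\varepsilon)$-strong extractor with uniform seed if for every random variable $X$ on $\{0,1\}^n$ with $H_{\min}(X)=-\log\max_x p_x\ge k$ and every uniform $Y$ independent of $X$, the variational distance between $(\mathrm{Ext}(X,Y),Y)$ and $(U_m,Y)$ is at most $\varepsilon$, where $U_m$ is uniform on $\{0,1\}^m$ and independent of $Y$. It is a quantum-proof $(k,\varepsilon)$-strong extractor with uniform seed if for every finite-dimensional quantum system $E$ and every state $\rho_{XE}=\sum_x p_x|x\rangle\langle x|\otimes\rho^x_E$ with $H_{\min}(X|E)\ge k$, and $Y$ uniform and independent of $XE$, $$\tfrac12\bigl\|\rho_{\mathrm{Ext}(X,Y)YE}-\rho_{U_m}\otimes\rho_Y\otimes\rho_E\bigr\|_{\mathrm{tr}}\le\varepsilon .$$ Here $H_{\min}(X|E)=\max_{\sigma_E}\{\lambda\in\mathbb R: 2^{-\lambda}\mathbb 1_X\otimes\sigma_E\ge\rho_{XE}\}$, with $\sigma_E$ ranging over normalized states. A code $C:\{0,1\}^n\to\{0,1\}^{\bar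 n}$ is $(\eta,L)$-list-decodable if for every $w\in\{0,1\}^{\bar n}$ there are at most $L$ messages $x$ such that $C(x)$ has relative Hamming distance at most $1/2-\eta$ from $w$. Sets $S_1,\dots,S_m\subset[d]$ form a weak $(t,1)$-design if $|S_i|=t$ and $\sum_{j<i}2^{|S_j\cap S_i|}\le m$ for all $i$; $y_S$ denotes the string of the bits of $y$ at the positions in $S$. There are absolute constants $a,K,c>0$ such that the following holds for all integers $n,m\ge1$ and all $0<\varepsilon\le1$. Put $\delta=\varepsilon^2/(9m^2)$, and for $t\in\mathbb N$ put $d=t\lceil t/\ln 2\rceil\lceil\log 4m\rceil$. 1. There are $t\le a\log(n/\delta)$ and a $(\delta/2,4/\delta^2)$-list-decodable code $\{0,1\}^n\to\{0,1\}^{2^t}$ such that the function $C:\{0,1\}^n\times\{0,1\}^t\to\{0,1\}$, whose value $C(x,y)$ is the bit at position $y$ of the codeword of $x$, is a $(3\log(1/\delta),\delta)$-strong extractor with uniform seed; and there is a weak $(t,1)$-design $S_1,\dots,S_m\subset[d]$. 2. Let $t\le a\log(n/\delta)$ and let $C:\{0,1\}^n\times\{0,1\}^t\to\{0,1\}$ be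 any $(3\log(1/\delta),\delta)$-strong extractor with uniform seed (in particular the one in 1). Then for every weak $(t,1)$-design $S_1,\dots,S_m\subset[d]$ the function $$\mathrm{Ext}:\{0,1\}^n\times\{0,1\}^d\to\{0,1\}^m,\qquad (x,y)\mapsto C(x,y_{S_1})\cdots C(x,y_{S_m}),$$ is a quantum-proof $(m+8\log m+8\log(1/\varepsilon)+K,\ \varepsilon)$-strong extractor with uniform seed. Moreover $d\le c\,t^2\log m$ if $m\ge2$, and $d\le c\,\log^2(n/\varepsilon)\log m$ if $2\le m\le n$. -/

import Mathlib

open scoped Matrix Kronecker MatrixOrder ComplexOrder BigOperators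

noncomputable section

/-- Bit strings of length `n`. -/
abbrev Bits (n : ℕ) : Type := Fin n → Bool

/-! ### Quantum states and conditional min-entropy -/

/-- The trace norm `tr √(A† A)`. -/
def traceNorm {ι : Type} [Fintype ι] [DecidableEq ι] (A : Matrix ι ι ℂ) : ℝ :=
  (CFC.sqrt (Aᴴ * A)).trace.re

/-- Normalized states (density operators) on the Hilbert space `ℂ^ι`. -/
def IsState {ι : Type} [Fintype ι] (ρ : Matrix ι ι ℂ) : Prop :=
  ρ.PosSemidef ∧ ρ.trace = 1

/-- The projector `|i⟩⟨i|` on a vector of the computational basis. -/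
def proj {ι : Type} [DecidableEq ι] (i : ι) : Matrix ι ι ℂ := Matrix.single i i 1

/-- The fully mixed state on `ℂ^ι`, i.e. a uniformly distributed classical variable. -/
def mixedState (ι : Type) [Fintype ι] [DecidableEq ι] : Matrix ι ι ℂ :=
  ((Fintype.card ι : ℝ)⁻¹) • (1 : Matrix ι ι ℂ)

/-- The conditional min-entropy `H_min(A|B)` of an operator on `ℂ^α ⊗ ℂ^β`: the largest `l` such
that `2^(-l) 1_A ⊗ σ_B ≥ ρ_AB` for some normalized state `σ_B`. If `ρ` is a normalized state, the
set below is nonempty and bounded above by `log₂ |α|`. -/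
def condMinEntropy {α β : Type} [Fintype α] [DecidableEq α] [Fintype β] [DecidableEq β]
    (ρ : Matrix (α × β) (α × β) ℂ) : ℝ :=
  sSup {l : ℝ | ∃ σ : Matrix β β ℂ, IsState σ ∧
    ρ ≤ ((2 : ℝ) ^ (-l)) • ((1 : Matrix α α ℂ) ⊗ₖ σ)}

/-- The classical-quantum operator `ρ_XE = ∑ x, |x⟩⟨x| ⊗ ρ_x`, where `ρ_x = p_x ρ^x` is positive
semidefinite. -/
def cqState {α β : Type} [Fintype α] [DecidableEq α] (ρ : α → Matrix β β ℂ) :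
    Matrix (α × β) (α × β) ℂ :=
  ∑ x, proj x ⊗ₖ ρ x

/-! ### Extractors -/

/-- `p` is a probability distribution on the finite set `α`. -/
def IsDistribution {α : Type} [Fintype α] (p : α → ℝ) : Prop :=
  (∀ x, 0 ≤ p x) ∧ ∑ x, p x = 1

/-- The min-entropy `-log₂ max_x p_x`. -/
def minEntropy {α : Type} (p : α → ℝ) : ℝ := -Real.logb 2 (⨆ x, p x)

/-- `(k, ε)`-strong extractor with uniform seed (no side information): for every source `X` with
min-entropy at least `k`, the variational distance between `(Ext(X,Y), Y)` and `(U, Y)`, with `Y`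
uniform and independent of `X` and with `U` uniform and independent of `Y`, is at most `ε`. -/
def IsStrongExtractor {n d : ℕ} {Z : Type} [Fintype Z] [DecidableEq Z]
    (k ε : ℝ) (Ext : Bits n → Bits d → Z) : Prop :=
  ∀ p : Bits n → ℝ, IsDistribution p → k ≤ minEntropy p →
    (1 / 2 : ℝ) * ∑ z : Z, ∑ y : Bits d,
      |(∑ x : Bits n with Ext x y = z, p x) * (1 / 2 ^ d)
        - (1 / Fintype.card Z) * (1 / 2 ^ d)| ≤ ε

/-- `ρ_{Ext(X,Y) Y E}` for `ρ_XE = ∑ x, |x⟩⟨x| ⊗ ρ_x` and a uniform seed `Y` that is independent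
of `XE`. -/
def extractedState {n d : ℕ} {Z E : Type} [DecidableEq Z]
    (Ext : Bits n → Bits d → Z) (ρ : Bits n → Matrix E E ℂ) :
    Matrix (Z × Bits d × E) (Z × Bits d × E) ℂ :=
  ∑ x : Bits n, ∑ y : Bits d,
    ((1 : ℝ) / 2 ^ d) • (proj (Ext x y) ⊗ₖ (proj y ⊗ₖ ρ x))

/-- Quantum-proof `(k, ε)`-strong extractor with uniform seed: for every (finite-dimensional)
system `E` and every state `ρ_XE` classical on `X` with `H_min(X|E) ≥ k`,
`½ ‖ρ_{Ext(X,Y) Y E} - ρ_U ⊗ ρ_Y ⊗ ρ_E‖ ≤ ε` in the trace norm. -/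
def IsQuantumProofStrongExtractor {n d : ℕ} {Z : Type} [Fintype Z] [DecidableEq Z]
    (k ε : ℝ) (Ext : Bits n → Bits d → Z) : Prop :=
  ∀ (E : Type) [Fintype E] [DecidableEq E] (ρ : Bits n → Matrix E E ℂ),
    (∀ x, (ρ x).PosSemidef) → ∑ x, (ρ x).trace = 1 → k ≤ condMinEntropy (cqState ρ) →
      (1 / 2 : ℝ) * traceNorm (extractedState Ext ρ
        - mixedState Z ⊗ₖ (mixedState (Bits d) ⊗ₖ ∑ x, ρ x)) ≤ ε

/-! ### Codes, weak designs, Trevisan's construction -/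

/-- `(ε, L)`-list-decodability of a code, given as an encoding map whose codewords are indexed by
the finite set `ι` of positions: every Hamming ball of relative radius `1/2 - ε` contains (the
encodings of) at most `L` messages. -/
def IsListDecodable {n : ℕ} {ι : Type} [Fintype ι] (code : Bits n → ι → Bool) (ε L : ℝ) : Prop :=
  ∀ w : ι → Bool,
    (({x : Bits n | (hammingDist (code x) w : ℝ) ≤ (1 / 2 - ε) * Fintype.card ι} :
      Finset (Bits n)).card : ℝ) ≤ L

/-- `S 0, …, S (m-1) ⊆ [d]` form a weak `(t, r)`-design. -/
structure IsWeakDesign {m d : ℕ} (t : ℕ) (r : ℝ) (S : Fin m → Finset (Fin d)) : Prop where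
  card_eq : ∀ i, (S i).card = t
  overlap : ∀ i, ∑ j ∈ Finset.Iio i, (2 : ℝ) ^ (S j ∩ S i).card ≤ r * m

/-- The substring `y_S` of `y` formed by the bits at the positions in `S`, in increasing order. -/
def substring {d t : ℕ} (y : Bits d) (S : Finset (Fin d)) (h : S.card = t) : Bits t :=
  fun i => y (S.orderEmbOfFin h i)

/-- Trevisan's extractor `(x, y) ↦ C(x, y_{S_1}) ⋯ C(x, y_{S_m})`. -/
def trevisan {n m d t : ℕ} (C : Bits n → Bits t → Bool) (S : Fin m → Finset (Fin d))
    (hS : ∀ i, (S i).card = t) : Bits n → Bits d → Bits m :=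
  fun x y i => C x (substring y (S i) (hS i))

/-- The seed length `d = t ⌈t / ln 2⌉ ⌈log₂ (4 m)⌉`. -/
def seedLength (t m : ℕ) : ℕ :=
  t * ⌈(t : ℝ) / Real.log 2⌉₊ * ⌈Real.logb 2 (4 * m)⌉₊

end

/-! Security. The trace norm is attained by pairing with a Hermitian contraction `T`. Telescoping
over output prefixes splits this pairing into `m` terms, one per output bit, each measuring how well
a contraction that knows the seed and the earlier outputs predicts that bit
(`re_trace_mul_extractedState_sub_eq_hybrid`). Once the seed bits outside `S i` are fixed, output `j
< i` depends only on the seed bits in `S j ∩ S i`; by the design condition the truth tables of all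
earlier outputs form an advice of at most `m` classical bits (`card_advice_le`).

The core is `IsStrongExtractor.quantum_bias_le`: a classical one-bit extractor withstands quantum
side information together with such advice. A weighted AM-GM inequality eliminates the arbitrary
observable in favour of a quadratic expression in the signed operators `A`. Expanded, that
expression contains the subnormalized joint weights of the source and the outcome of a pretty good
measurement, which does not depend on the seed. The operator bound `ρ x ≤ c • σ` bounds these
weights for each outcome, so the classical extractor property applies to each outcome separately.
The price is a square root, `δ` becoming `5 / 2 * √δ`, whence `δ` of order `ε² / m²`.

Existence. Polynomial evaluation concatenated with the Hadamard code has small pairwise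
correlations. One second-moment estimate (`HasSmallCorrelation.sq_sum_abs_le`) then gives both
list-decodability and the extractor property, neither deduced from the other. Designs consist of
graphs of functions, chosen greedily within dyadic blocks of indices and placed disjointly for
different blocks. -/

noncomputable section

/-! ### Trace inequalities -/

namespace Matrix

variable {ι : Type} [Fintype ι] [DecidableEq ι]

/-- The trace of a product of two positive semidefinite matrices is nonnegative. -/
lemma PosSemidef.re_trace_mul_nonneg {A B : Matrix ι ι ℂ} (hA : A.PosSemidef)
    (hB : B.PosSemidef) : 0 ≤ (A * B).trace.re := by
  have hs : (CFC.sqrt B).PosSemidef := nonneg_iff_posSemidef.1 (CFC.sqrt_nonneg B)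
  have h : CFC.sqrt B * CFC.sqrt B = B :=
    CFC.sqrt_mul_sqrt_self B (nonneg_iff_posSemidef.2 hB)
  have h2 := (hA.conjTranspose_mul_mul_same (CFC.sqrt B)).trace_nonneg
  rw [hs.1.eq, trace_mul_comm, ← mul_assoc, h, trace_mul_comm] at h2
  exact (Complex.le_def.1 h2).1

lemma re_trace_mul_le_of_le {A B P : Matrix ι ι ℂ} (h : A ≤ B) (hP : P.PosSemidef) :
    (A * P).trace.re ≤ (B * P).trace.re := by
  have := PosSemidef.re_trace_mul_nonneg (le_iff.1 h) hP
  rw [sub_mul, trace_sub, Complex.sub_re] at this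
  linarith

/-- The trace norm of a Hermitian matrix is attained by a Hermitian contraction. -/
lemma exists_contraction_traceNorm {M : Matrix ι ι ℂ} (hM : M.IsHermitian) :
    ∃ T : Matrix ι ι ℂ, -1 ≤ T ∧ T ≤ 1 ∧ traceNorm M = (T * M).trace.re := by
  have hfin : (spectrum ℝ M).Finite := Matrix.finite_real_spectrum
  have hM' : IsSelfAdjoint M := hM
  -- The witness is `sgn M`, since `sgn M * M = |M|`. The sign function is admissible in the
  -- functional calculus because the spectrum is finite, so every function is continuous on it.
  refine ⟨cfc (fun x : ℝ => (SignType.sign x : ℝ)) M, ?_, ?_, ?_⟩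
  · have := algebraMap_le_cfc (fun x : ℝ => (SignType.sign x : ℝ)) (-1) M
      (fun x _ => by rcases SignType.sign x <;> simp) (hfin.continuousOn _) hM'
    simpa using this
  · exact cfc_le_one _ _ (fun x _ => by rcases SignType.sign x <;> simp)
  · have h1 : CFC.sqrt (Mᴴ * M) = CFC.abs M := rfl
    have h2 : cfc (fun x : ℝ => (SignType.sign x : ℝ)) M * M = CFC.abs M := by
      rw [CFC.abs_eq_cfc_norm M hM']
      conv_lhs => enter [2]; rw [← cfc_id' ℝ M hM']
      rw [← cfc_mul _ _ M (hfin.continuousOn _) (hfin.continuousOn _)]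
      congr 1
      funext x
      simp [Real.norm_eq_abs]
    rw [traceNorm, h1, h2]

/-- Weighted arithmetic-geometric mean inequality for the Hilbert-Schmidt pairing of a Hermitian
contraction with a Hermitian matrix; `D` is the square root of the weight. -/
lemma re_trace_mul_le_weighted {R A D : Matrix ι ι ℂ} (h1 : -1 ≤ R) (h2 : R ≤ 1)
    (hA : A.IsHermitian) (hD : D.PosDef) {s : ℝ} (hs : 0 < s) :
    (R * A).trace.re ≤ s / 2 * (D * D).trace.re + s⁻¹ / 2 * (A * D⁻¹ * A * D⁻¹).trace.re := by
  have hR : R.IsHermitian := by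
    have := (le_iff.1 h2).1
    have h3 : R = 1 - (1 - R) := by abel
    rw [h3]; exact isHermitian_one.sub this
  have hN : (1 + R).PosSemidef := by
    have := le_iff.1 h1
    rwa [sub_neg_eq_add, add_comm] at this
  have hP : (1 - R).PosSemidef := le_iff.1 h2
  -- Expand `0 ≤ tr (D (1 - R) D (1 + R))`; the two terms linear in `R` cancel by cyclicity of the
  -- trace.
  have key : (D * R * D * R).trace.re ≤ (D * D).trace.re := by
    have h := PosSemidef.re_trace_mul_nonneg
      (hP.conjTranspose_mul_mul_same D) hN
    rw [hD.1.eq] at h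
    have e : D * (1 - R) * D * (1 + R)
        = D * D + D * D * R - D * R * D - D * R * D * R := by noncomm_ring
    have e2 : (D * D * R).trace = (D * R * D).trace := by
      rw [mul_assoc, trace_mul_comm]
    rw [e] at h
    simp only [trace_sub, trace_add, Complex.sub_re, Complex.add_re, e2] at h
    linarith
  set β := CFC.sqrt D with hβ
  have hβs : β.PosSemidef := nonneg_iff_posSemidef.1 (CFC.sqrt_nonneg D)
  have hββ : β * β = D := CFC.sqrt_mul_sqrt_self D (nonneg_iff_posSemidef.2 hD.posSemidef)
  have hdet : IsUnit β.det := by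
    have : IsUnit D.det := (isUnit_iff_isUnit_det _).1 hD.isUnit
    rw [← hββ, det_mul] at this
    exact isUnit_of_mul_isUnit_left this
  have hDi : D⁻¹ = β⁻¹ * β⁻¹ := by rw [← hββ, mul_inv_rev]
  have c1 : β⁻¹ * β = 1 := nonsing_inv_mul _ hdet
  have c2 : β * β⁻¹ = 1 := mul_nonsing_inv _ hdet
  have hβi : β⁻¹.IsHermitian := hβs.1.inv
  -- With `β = √D`, the inequality is `0 ≤ tr X²`: the cross terms give `-2 s tr (R A)`, and the
  -- square of the first term is bounded by `key`.
  set X := (s : ℂ) • (β * R * β) - β⁻¹ * A * β⁻¹ with hX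
  have hXH : Xᴴ = X := by
    simp [hX, conjTranspose_sub, conjTranspose_smul, conjTranspose_mul, hβs.1.eq, hR.eq, hβi.eq,
      hA.eq, mul_assoc]
  have hpos : 0 ≤ (X * X).trace.re := by
    have := (posSemidef_conjTranspose_mul_self X).trace_nonneg
    rw [hXH] at this
    exact (Complex.le_def.1 this).1
  have t1 : (β * R * β * (β * R * β)).trace = (D * R * D * R).trace := by
    rw [show β * R * β * (β * R * β) = β * (R * (β * β) * R * β) by noncomm_ring, trace_mul_comm,
      show R * (β * β) * R * β * β = (R * (β * β) * R) * (β * β) by noncomm_ring, trace_mul_comm,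
      hββ]
    simp only [mul_assoc]
  have t2 : (β * R * β * (β⁻¹ * A * β⁻¹)).trace = (R * A).trace := by
    rw [show β * R * β * (β⁻¹ * A * β⁻¹) = β * (R * (β * β⁻¹) * A * β⁻¹) by noncomm_ring,
      trace_mul_comm, c2]
    rw [show R * 1 * A * β⁻¹ * β = R * A * (β⁻¹ * β) by noncomm_ring, c1, mul_one]
  have t3 : (β⁻¹ * A * β⁻¹ * (β * R * β)).trace = (R * A).trace := by
    rw [trace_mul_comm, t2]
  have t4 : (β⁻¹ * A * β⁻¹ * (β⁻¹ * A * β⁻¹)).trace = (A * D⁻¹ * A * D⁻¹).trace := by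
    rw [hDi, show β⁻¹ * A * β⁻¹ * (β⁻¹ * A * β⁻¹) = β⁻¹ * (A * (β⁻¹ * β⁻¹) * A * β⁻¹) by
      noncomm_ring, trace_mul_comm]
    congr 1; noncomm_ring
  have e : X * X = ((s : ℂ) * s) • (β * R * β * (β * R * β))
      - (s : ℂ) • (β * R * β * (β⁻¹ * A * β⁻¹)) - (s : ℂ) • (β⁻¹ * A * β⁻¹ * (β * R * β))
      + β⁻¹ * A * β⁻¹ * (β⁻¹ * A * β⁻¹) := by
    rw [hX]
    generalize β * R * β = P
    generalize β⁻¹ * A * β⁻¹ = Q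
    simp only [sub_mul, mul_sub, smul_mul_assoc, mul_smul_comm, smul_sub, smul_smul]
    abel
  rw [e, trace_add, trace_sub, trace_sub, trace_smul, trace_smul, trace_smul, t1, t2, t3, t4]
    at hpos
  simp only [Complex.add_re, Complex.sub_re, smul_eq_mul, ← Complex.ofReal_mul,
    Complex.re_ofReal_mul] at hpos
  have hfin : (R * A).trace.re = s⁻¹ / 2 * (2 * s * (R * A).trace.re) := by
    field_simp
  rw [hfin]
  calc _ ≤ s⁻¹ / 2 * (s * s * (D * D).trace.re + (A * D⁻¹ * A * D⁻¹).trace.re) := by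
        apply mul_le_mul_of_nonneg_left _ (by positivity)
        have := mul_le_mul_of_nonneg_left key (mul_pos hs hs).le
        linarith
    _ = _ := by field_simp

end Matrix

/-! ### Bias of one-bit extractors -/

/-- The sign `(-1)^b` of a bit. -/
def boolSign (b : Bool) : ℝ := if b then -1 else 1

lemma abs_boolSign (b : Bool) : |boolSign b| = 1 := by cases b <;> simp [boolSign]

lemma boolSign_mul_self (b : Bool) : boolSign b * boolSign b = 1 := by cases b <;> simp [boolSign]

lemma sum_boolSign_mul {α : Type} [Fintype α] (f : α → Bool) (p : α → ℝ) :
    ∑ x, boolSign (f x) * p x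
      = ∑ x with f x = false, p x - ∑ x with f x = true, p x := by
  rw [Finset.sum_filter, Finset.sum_filter, ← Finset.sum_sub_distrib]
  refine Finset.sum_congr rfl fun x _ => ?_
  cases f x <;> simp [boolSign]

lemma sum_filter_false_add_true {α : Type} [Fintype α] (f : α → Bool) (p : α → ℝ) :
    ∑ x with f x = false, p x + ∑ x with f x = true, p x = ∑ x, p x := by
  rw [Finset.sum_filter, Finset.sum_filter, ← Finset.sum_add_distrib]
  refine Finset.sum_congr rfl fun x _ => ?_
  cases f x <;> simp

/-- The statistical distance from uniform of an extracted bit is half its average bias. -/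
lemma sum_dist_bool_eq {n t : ℕ} (C : Bits n → Bits t → Bool) {p : Bits n → ℝ}
    (hp : ∑ x, p x = 1) :
    (1 / 2 : ℝ) * ∑ z : Bool, ∑ y : Bits t,
      |(∑ x : Bits n with C x y = z, p x) * (1 / 2 ^ t)
        - (1 / Fintype.card Bool) * (1 / 2 ^ t)|
      = 1 / 2 * (1 / 2 ^ t * ∑ y, |∑ x, boolSign (C x y) * p x|) := by
  congr 1
  rw [Finset.sum_comm, Finset.mul_sum]
  refine Finset.sum_congr rfl fun y _ => ?_
  have h1 := sum_boolSign_mul (fun x => C x y) p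
  have h2 := sum_filter_false_add_true (fun x => C x y) p
  rw [hp] at h2
  rw [h1, Fintype.sum_bool]
  set a := ∑ x with C x y = false, p x
  set b := ∑ x with C x y = true, p x
  have hb : b = 1 - a := by linarith
  have e1 : b * (1 / 2 ^ t) - 1 / (Fintype.card Bool : ℝ) * (1 / 2 ^ t)
      = -((a - 1 / 2) * (1 / 2 ^ t)) := by
    rw [hb, Fintype.card_bool]; push_cast; ring
  have e2 : a * (1 / 2 ^ t) - 1 / (Fintype.card Bool : ℝ) * (1 / 2 ^ t)
      = (a - 1 / 2) * (1 / 2 ^ t) := by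
    rw [Fintype.card_bool]; push_cast; ring
  have e3 : a - b = 2 * (a - 1 / 2) := by rw [hb]; ring
  rw [e1, e2, e3, abs_neg, abs_mul, abs_mul, abs_of_pos (by positivity : (0 : ℝ) < 1 / 2 ^ t),
    abs_of_pos (by norm_num : (0 : ℝ) < 2)]
  ring

/-- Being a distribution makes the supremum positive, so that the logarithm can be inverted. -/
lemma le_minEntropy_iff {α : Type} [Fintype α] {p : α → ℝ} (hp : IsDistribution p) (k : ℝ) :
    k ≤ minEntropy p ↔ ∀ x, p x ≤ (2 : ℝ) ^ (-k) := by
  have hne : Nonempty α := by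
    by_contra h
    rw [not_nonempty_iff] at h
    simpa using hp.2
  have hbdd : BddAbove (Set.range p) := (Set.finite_range p).bddAbove
  have hpos : 0 < ⨆ x, p x := by
    by_contra h
    push Not at h
    have : ∑ x, p x ≤ 0 := Finset.sum_nonpos fun x _ => (le_ciSup hbdd x).trans h
    linarith [hp.2]
  rw [minEntropy, le_neg, Real.logb_le_iff_le_rpow one_lt_two hpos, ciSup_le_iff hbdd]

/-- Average bias of an extracted bit, for an unnormalized source whose weights are at most `b`. -/
lemma IsStrongExtractor.sum_abs_bias_le {n t : ℕ} {C : Bits n → Bits t → Bool} {k δ : ℝ}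
    (hC : IsStrongExtractor k δ C) (hδ : 0 ≤ δ) {q : Bits n → ℝ} (hq : ∀ x, 0 ≤ q x) {b : ℝ}
    (hb : ∀ x, q x ≤ b) :
    ∑ v, |∑ x, boolSign (C x v) * q x|
      ≤ 2 ^ t * (2 * δ * ∑ x, q x + (2 : ℝ) ^ k * b) := by
  have hb0 : 0 ≤ b := (hq 0).trans (hb 0)
  set Q := ∑ x, q x with hQ
  have hQ0 : 0 ≤ Q := Finset.sum_nonneg fun x _ => hq x
  -- Either `q / Q` has min-entropy at least `k` and the extractor applies, or the total mass is at
  -- most `2 ^ k * b` and the trivial bound suffices.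
  by_cases hsmall : b ≤ (2 : ℝ) ^ (-k) * Q ∧ 0 < Q
  · obtain ⟨h1, h2⟩ := hsmall
    have hd : IsDistribution fun x => q x / Q :=
      ⟨fun x => div_nonneg (hq x) hQ0, by rw [← Finset.sum_div, div_self h2.ne']⟩
    have h := hC _ hd ((le_minEntropy_iff hd k).2 fun x => by
      rw [div_le_iff₀ h2]; exact (hb x).trans h1)
    rw [sum_dist_bool_eq C hd.2] at h
    have e : ∑ y, |∑ x, boolSign (C x y) * (q x / Q)|
        = (∑ y, |∑ x, boolSign (C x y) * q x|) / Q := by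
      rw [Finset.sum_div]
      refine Finset.sum_congr rfl fun y _ => ?_
      rw [← abs_of_pos h2, ← abs_div, abs_of_pos h2, Finset.sum_div]
      simp only [mul_div_assoc]
    rw [e] at h
    have hh : (∑ y, |∑ x, boolSign (C x y) * q x|) ≤ 2 ^ t * (2 * δ * Q) := by
      have : (∑ y, |∑ x, boolSign (C x y) * q x|)
          = 2 ^ t * (2 * (1 / 2 * (1 / 2 ^ t * ((∑ y, |∑ x, boolSign (C x y) * q x|) / Q)))
            * Q) := by
        field_simp
      rw [this]
      gcongr
    refine hh.trans ?_
    gcongr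
    have : 0 ≤ (2 : ℝ) ^ k * b := by positivity
    linarith
  · have hQb : Q ≤ (2 : ℝ) ^ k * b := by
      rcases not_and_or.1 hsmall with h | h
      · push Not at h
        calc Q = (2 : ℝ) ^ k * ((2 : ℝ) ^ (-k) * Q) := by
              rw [← mul_assoc, ← Real.rpow_add two_pos]; simp
          _ ≤ _ := by gcongr
      · exact (not_lt.1 h).trans (by positivity)
    calc _ ≤ ∑ _v : Bits t, Q := by
          refine Finset.sum_le_sum fun v _ => (Finset.abs_sum_le_sum_abs _ _).trans ?_
          refine le_of_eq (Finset.sum_congr rfl fun x _ => ?_)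
          rw [abs_mul, abs_boolSign, one_mul, abs_of_nonneg (hq x)]
      _ = 2 ^ t * Q := by simp
      _ ≤ _ := by
        gcongr
        have : 0 ≤ 2 * δ * Q := by positivity
        linarith

/-! ### One-bit extractors against quantum side information -/

namespace Matrix

variable {ι : Type} [Fintype ι] [DecidableEq ι]

/-- A positive definite matrix has a positive definite square root. -/
lemma PosDef.exists_sqrt {τ : Matrix ι ι ℂ} (h : τ.PosDef) :
    ∃ D : Matrix ι ι ℂ, D.PosDef ∧ D * D = τ := by
  refine ⟨CFC.sqrt τ, ?_, CFC.sqrt_mul_sqrt_self τ (nonneg_iff_posSemidef.2 h.posSemidef)⟩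
  have hs : (CFC.sqrt τ).PosSemidef := nonneg_iff_posSemidef.1 (CFC.sqrt_nonneg τ)
  rw [hs.posDef_iff_isUnit, isUnit_iff_isUnit_det]
  have h1 : IsUnit τ.det := (isUnit_iff_isUnit_det _).1 h.isUnit
  rw [← CFC.sqrt_mul_sqrt_self τ (nonneg_iff_posSemidef.2 h.posSemidef), det_mul] at h1
  exact isUnit_of_mul_isUnit_left h1

lemma PosDef.inv_mul_mul_inv_le_one {D P : Matrix ι ι ℂ} (hD : D.PosDef) (h : P ≤ D * D) :
    D⁻¹ * P * D⁻¹ ≤ 1 := by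
  have hdet : IsUnit D.det := (isUnit_iff_isUnit_det _).1 hD.isUnit
  have h1 := (le_iff.1 h).conjTranspose_mul_mul_same D⁻¹
  rw [hD.1.inv.eq] at h1
  rw [le_iff]
  convert h1 using 1
  rw [mul_sub, sub_mul]
  congr 1
  rw [← mul_assoc, nonsing_inv_mul _ hdet, one_mul, mul_nonsing_inv _ hdet]

end Matrix

namespace Matrix

/-- A positive semidefinite matrix is dominated by a positive definite one of slightly larger
trace. -/
lemma PosSemidef.exists_posDef_sqrt {E : Type} [Fintype E] [DecidableEq E] {P : Matrix E E ℂ}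
    (hP : P.PosSemidef) {η : ℝ} (hη : 0 < η) :
    ∃ D : Matrix E E ℂ, D.PosDef ∧ P ≤ D * D ∧ (D * D).trace.re ≤ P.trace.re + η := by
  set ζ : ℝ := η / (Fintype.card E + 1)
  have hζ : 0 < ζ := by positivity
  have h1 : (ζ • (1 : Matrix E E ℂ)).PosDef := PosDef.one.smul hζ
  have h2 : (P + ζ • (1 : Matrix E E ℂ)).PosDef := PosDef.posSemidef_add hP h1
  obtain ⟨D, hD, hDD⟩ := h2.exists_sqrt
  refine ⟨D, hD, ?_, ?_⟩
  · rw [hDD, le_iff, add_sub_cancel_left]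
    exact h1.posSemidef
  · rw [hDD, trace_add, trace_smul, trace_one, Complex.add_re, Complex.smul_re, Complex.natCast_re,
      smul_eq_mul]
    gcongr
    rw [div_mul_eq_mul_div, div_le_iff₀ (by positivity)]
    nlinarith

end Matrix

open Matrix in
/-- One-bit extractors against quantum side information `E` and a classical advice `γ X`: no
family of observables `R g v` with spectrum in `[-1, 1]` predicts the extracted bit. -/
lemma IsStrongExtractor.quantum_bias_le {n t : ℕ} {C : Bits n → Bits t → Bool} {k δ : ℝ}
    (hC : IsStrongExtractor k δ C) (hδ : 0 < δ)
    {E Γ : Type} [Fintype E] [DecidableEq E] [Fintype Γ] [DecidableEq Γ]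
    {ρ : Bits n → Matrix E E ℂ} (hρ : ∀ x, (ρ x).PosSemidef) (htr : ∑ x, (ρ x).trace = 1)
    {σ : Matrix E E ℂ} (hσ : IsState σ) {c : ℝ} (hc : 0 ≤ c) (hρσ : ∀ x, ρ x ≤ c • σ)
    (γ : Bits n → Γ) (hΓ : (2 : ℝ) ^ k * c * Fintype.card Γ ≤ δ)
    {R : Γ → Bits t → Matrix E E ℂ} (hR1 : ∀ g v, -1 ≤ R g v) (hR2 : ∀ g v, R g v ≤ 1) :
    ∑ v, ∑ x, boolSign (C x v) * (R (γ x) v * ρ x).trace.re ≤ 2 ^ t * (5 / 2 * √δ) := by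
  set F : Γ → Finset (Bits n) := fun g => Finset.univ.filter fun x => γ x = g with hF
  have hmem : ∀ {g x}, x ∈ F g → γ x = g := fun h => (Finset.mem_filter.1 h).2
  set P : Γ → Matrix E E ℂ := fun g => ∑ x ∈ F g, ρ x with hPdef
  have hP : ∀ g, (P g).PosSemidef := fun g => posSemidef_sum _ fun x _ => hρ x
  -- Making all the `P g` invertible then adds at most 1 to the total trace.
  set η : ℝ := 1 / (Fintype.card Γ + 1)
  have hη : 0 < η := by positivity
  choose D hD hPD hDtr using fun g => (hP g).exists_posDef_sqrt hη
  have hPtr : ∑ g, (P g).trace.re = 1 := by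
    have : ∑ g, (P g).trace = 1 := by
      rw [← htr, ← Finset.sum_fiberwise Finset.univ γ]
      simp only [hPdef, trace_sum, hF]
    rw [← Complex.re_sum, this, Complex.one_re]
  have hDsum : ∑ g, (D g * D g).trace.re ≤ 2 := by
    calc _ ≤ ∑ g, ((P g).trace.re + η) := Finset.sum_le_sum fun g _ => hDtr g
      _ = 1 + Fintype.card Γ * η := by
        rw [Finset.sum_add_distrib, hPtr, Finset.sum_const, Finset.card_univ, nsmul_eq_mul]
      _ ≤ 2 := by
        have : (Fintype.card Γ : ℝ) * η ≤ 1 := by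
          rw [mul_one_div, div_le_one (by positivity)]; linarith
        linarith
  -- the pretty good measurement
  set W : Bits n → Matrix E E ℂ := fun x => (D (γ x))⁻¹ * ρ x * (D (γ x))⁻¹ with hW
  have hWpos : ∀ x, (W x).PosSemidef := fun x => by
    have := (hρ x).conjTranspose_mul_mul_same (D (γ x))⁻¹
    rwa [(hD _).1.inv.eq] at this
  have hWsum : ∀ g, ∑ x ∈ F g, W x = (D g)⁻¹ * P g * (D g)⁻¹ := fun g => by
    rw [hPdef, Finset.mul_sum, Finset.sum_mul]
    exact Finset.sum_congr rfl fun x hx => by simp only [hW, hmem hx]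
  have hWle : ∀ g, ∑ x ∈ F g, W x ≤ 1 := fun g => by
    rw [hWsum]; exact (hD g).inv_mul_mul_inv_le_one (hPD g)
  -- `q x' x` is the weight of the source value `x` together with the measurement outcome `x'`; the
  -- advice selects the measurement. For each fixed `x'` it is an unnormalized classical source
  -- independent of the seed.
  set q : Bits n → Bits n → ℝ := fun x' x => if γ x = γ x' then (ρ x * W x').trace.re else 0
    with hq
  have hq0 : ∀ x' x, 0 ≤ q x' x := fun x' x => by
    simp only [hq]; split_ifs
    exacts [(hρ x).re_trace_mul_nonneg (hWpos x'), le_rfl]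
  set w : Bits n → ℝ := fun x' => (σ * W x').trace.re with hw
  have hw0 : ∀ x', 0 ≤ w x' := fun x' => hσ.1.re_trace_mul_nonneg (hWpos x')
  have hqw : ∀ x' x, q x' x ≤ c * w x' := fun x' x => by
    simp only [hq]; split_ifs
    · have := re_trace_mul_le_of_le (hρσ x) (hWpos x')
      rwa [smul_mul_assoc, trace_smul, Complex.smul_re, smul_eq_mul] at this
    · exact mul_nonneg hc (hw0 x')
  have hqsum : ∀ x', ∀ f : Bits n → ℝ,
      ∑ x, f x * q x' x = ∑ x ∈ F (γ x'), f x * (ρ x * W x').trace.re := fun x' f => by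
    simp only [hq, hF, mul_ite, mul_zero, Finset.sum_filter]
  have hwsum : ∑ x', w x' ≤ Fintype.card Γ := by
    rw [← Finset.sum_fiberwise Finset.univ γ]
    calc _ = ∑ g, (σ * ∑ x ∈ F g, W x).trace.re := by
          refine Finset.sum_congr rfl fun g _ => ?_
          rw [Finset.mul_sum, trace_sum, Complex.re_sum]
      _ ≤ ∑ _g : Γ, (1 : ℝ) := by
          refine Finset.sum_le_sum fun g _ => ?_
          rw [trace_mul_comm]
          refine (re_trace_mul_le_of_le (hWle g) hσ.1).trans ?_
          rw [one_mul, hσ.2, Complex.one_re]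
      _ = _ := by simp
  have hQsum : ∑ x', ∑ x, q x' x ≤ 1 := by
    rw [← Finset.sum_fiberwise Finset.univ γ]
    calc _ = ∑ g, (P g * ∑ x ∈ F g, W x).trace.re := by
          refine Finset.sum_congr rfl fun g _ => ?_
          rw [Finset.mul_sum, trace_sum, Complex.re_sum]
          refine Finset.sum_congr rfl fun x' hx' => ?_
          have := hqsum x' fun _ => 1
          simp only [one_mul] at this
          rw [this, hmem hx', Finset.sum_mul, trace_sum, Complex.re_sum]
      _ ≤ ∑ g, (P g).trace.re := by
          refine Finset.sum_le_sum fun g _ => ?_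
          rw [trace_mul_comm]
          refine (re_trace_mul_le_of_le (hWle g) (hP g)).trans ?_
          rw [one_mul]
      _ = 1 := hPtr
  set A : Γ → Bits t → Matrix E E ℂ := fun g v => ∑ x ∈ F g, boolSign (C x v) • ρ x with hA
  have hAH : ∀ g v, (A g v).IsHermitian := fun g v => by
    rw [IsHermitian, hA, conjTranspose_sum]
    refine Finset.sum_congr rfl fun x _ => ?_
    rw [conjTranspose_smul, (hρ x).1.eq, star_trivial]
  -- Expanding one factor `A` over `x'` and the other over `x` produces the sources `q x'`. Of the
  -- `3 * δ`, `2 * δ` is the bias of the extractor and `δ` comes from the outcomes of low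
  -- conditional min-entropy, through `hΓ`.
  have hX : ∑ v, ∑ g, (A g v * (D g)⁻¹ * A g v * (D g)⁻¹).trace.re ≤ 2 ^ t * (3 * δ) := by
    have e : ∀ v g, (A g v * (D g)⁻¹ * A g v * (D g)⁻¹).trace.re
        = ∑ x' ∈ F g, boolSign (C x' v) * ∑ x, boolSign (C x v) * q x' x := fun v g => by
      have e1 : (D g)⁻¹ * A g v * (D g)⁻¹ = ∑ x' ∈ F g, boolSign (C x' v) • W x' := by
        rw [hA, Finset.mul_sum, Finset.sum_mul]
        refine Finset.sum_congr rfl fun x hx => ?_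
        simp only [hW, hmem hx, mul_smul_comm, smul_mul_assoc]
      rw [mul_assoc, mul_assoc, ← mul_assoc (D g)⁻¹, e1, Finset.mul_sum, trace_sum,
        Complex.re_sum]
      refine Finset.sum_congr rfl fun x' hx' => ?_
      rw [hqsum, hmem hx', mul_smul_comm, trace_smul, Complex.smul_re, smul_eq_mul, hA,
        Finset.sum_mul, trace_sum, Complex.re_sum]
      congr 1
      refine Finset.sum_congr rfl fun x _ => ?_
      rw [smul_mul_assoc, trace_smul, Complex.smul_re, smul_eq_mul]
    calc _ = ∑ v, ∑ x', boolSign (C x' v) * ∑ x, boolSign (C x v) * q x' x := by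
          refine Finset.sum_congr rfl fun v _ => ?_
          rw [← Finset.sum_fiberwise Finset.univ γ]
          exact Finset.sum_congr rfl fun g _ => e v g
      _ = ∑ x', ∑ v, boolSign (C x' v) * ∑ x, boolSign (C x v) * q x' x := Finset.sum_comm
      _ ≤ ∑ x', ∑ v, |∑ x, boolSign (C x v) * q x' x| := by
          refine Finset.sum_le_sum fun x' _ => Finset.sum_le_sum fun v _ => ?_
          refine (le_abs_self _).trans ?_
          rw [abs_mul, abs_boolSign, one_mul]
      _ ≤ ∑ x', 2 ^ t * (2 * δ * ∑ x, q x' x + (2 : ℝ) ^ k * (c * w x')) :=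
          Finset.sum_le_sum fun x' _ => hC.sum_abs_bias_le hδ.le (hq0 x') (hqw x')
      _ = 2 ^ t * (2 * δ * (∑ x', ∑ x, q x' x) + (2 : ℝ) ^ k * c * ∑ x', w x') := by
          rw [← Finset.mul_sum, Finset.sum_add_distrib, Finset.mul_sum, Finset.mul_sum]
          simp only [mul_assoc]
      _ ≤ 2 ^ t * (2 * δ * 1 + (2 : ℝ) ^ k * c * Fintype.card Γ) := by gcongr
      _ ≤ _ := by gcongr; linarith
  have hs : 0 < √δ := Real.sqrt_pos.2 hδ
  calc _ = ∑ v, ∑ g, (R g v * A g v).trace.re := by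
        refine Finset.sum_congr rfl fun v _ => ?_
        rw [← Finset.sum_fiberwise Finset.univ γ]
        refine Finset.sum_congr rfl fun g _ => ?_
        rw [hA, Finset.mul_sum, trace_sum, Complex.re_sum]
        refine Finset.sum_congr rfl fun x hx => ?_
        rw [mul_smul_comm, trace_smul, Complex.smul_re, smul_eq_mul, hmem hx]
    -- The weight `s = √δ` balances a first sum of order 1 against a second of order `δ`.
    _ ≤ ∑ v, ∑ g, (√δ / 2 * (D g * D g).trace.re
          + (√δ)⁻¹ / 2 * (A g v * (D g)⁻¹ * A g v * (D g)⁻¹).trace.re) :=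
        Finset.sum_le_sum fun v _ => Finset.sum_le_sum fun g _ =>
          re_trace_mul_le_weighted (hR1 g v) (hR2 g v) (hAH g v) (hD g) hs
    _ = 2 ^ t * (√δ / 2 * ∑ g, (D g * D g).trace.re)
          + (√δ)⁻¹ / 2 * ∑ v, ∑ g, (A g v * (D g)⁻¹ * A g v * (D g)⁻¹).trace.re := by
        simp only [Finset.sum_add_distrib, Finset.mul_sum, Finset.sum_const, Finset.card_univ,
          nsmul_eq_mul, Fintype.card_pi_const, Fintype.card_bool]
        push_cast
        rfl
    _ ≤ 2 ^ t * (√δ / 2 * 2) + (√δ)⁻¹ / 2 * (2 ^ t * (3 * δ)) := by gcongr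
    _ = _ := by
        have : (√δ)⁻¹ * δ = √δ := by
          rw [inv_mul_eq_div, Real.div_sqrt]
        linear_combination (3 / 2 * 2 ^ t) * this

/-! ### The hybrid argument -/

/-- Telescoping the indicator of a string over its prefixes. -/
lemma indicator_sub_uniform_eq_sum {m : ℕ} (a z : Bits m) :
    (if a = z then (1 : ℝ) else 0) - 1 / 2 ^ m
      = ∑ i : Fin m, (1 / 2 ^ (m - i : ℕ)) * (if ∀ j < i, a j = z j then 1 else 0)
          * boolSign (z i) * boolSign (a i) := by
  -- Hybrid `k`: the first `k` bits come from `a`, the remaining ones are uniform.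
  set P : ℕ → ℝ := fun k =>
    (1 / 2 ^ (m - k)) * (if ∀ j : Fin m, (j : ℕ) < k → a j = z j then 1 else 0) with hP
  have h0 : P 0 = 1 / 2 ^ m := by simp [hP]
  have hm : P m = if a = z then 1 else 0 := by simp [hP, funext_iff]
  rw [← h0, ← hm, ← Finset.sum_range_sub, ← Fin.sum_univ_eq_sum_range (fun k => P (k + 1) - P k)]
  refine Finset.sum_congr rfl fun i _ => ?_
  have hpow : (2 : ℝ) ^ (m - i : ℕ) = 2 * 2 ^ (m - (i + 1) : ℕ) := by
    rw [← pow_succ']; congr 1; omega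
  have hsplit : (∀ j : Fin m, (j : ℕ) < i + 1 → a j = z j) ↔ (∀ j < i, a j = z j) ∧ a i = z i := by
    constructor
    · exact fun h => ⟨fun j hj => h j (Nat.lt_succ_of_lt hj), h i (Nat.lt_succ_self _)⟩
    · rintro ⟨h1, h2⟩ j hj
      rcases (Nat.lt_succ_iff_lt_or_eq.1 hj) with h | h
      · exact h1 j h
      · rw [Fin.ext h]; exact h2
  have hlt : (∀ j : Fin m, (j : ℕ) < i → a j = z j) ↔ ∀ j < i, a j = z j := Iff.rfl
  simp only [hP, hsplit, hpow, hlt]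
  by_cases h : ∀ j < i, a j = z j
  · have hT : (∀ j < i, a j = z j) = True := eq_true h
    simp only [hT]
    cases ha : a i <;> cases hz : z i <;> simp [boolSign] <;> field_simp <;> norm_num
  · have hT : (∀ j < i, a j = z j) = False := eq_false h
    simp [hT]

/-- There are `2 ^ (m - i)` strings with a given prefix of length `i`. -/
lemma sum_prefix_indicator {m : ℕ} (i : Fin m) (u : Bits m) :
    ∑ z : Bits m, (1 / 2 ^ (m - i : ℕ)) * (if ∀ j < i, u j = z j then (1 : ℝ) else 0) = 1 := by
  have h : (Finset.univ.filter fun z : Bits m => ∀ j < i, u j = z j)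
      = Fintype.piFinset fun j => if j < i then {u j} else Finset.univ := by
    ext z
    simp only [Finset.mem_filter, Finset.mem_univ, true_and, Fintype.mem_piFinset]
    refine forall_congr' fun j => ?_
    by_cases hj : j < i
    · simpa [hj] using eq_comm
    · simp [hj]
  have hcard : (Finset.univ.filter fun z : Bits m => ∀ j < i, u j = z j).card = 2 ^ (m - i : ℕ) := by
    rw [h, Fintype.card_piFinset]
    have : ∀ j, (if j < i then {u j} else (Finset.univ : Finset Bool)).card
        = if j < i then 1 else 2 := fun j => by split_ifs <;> simp
    simp only [this, Finset.prod_ite, Finset.prod_const, one_pow, one_mul]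
    congr 1
    simp only [not_lt]
    rw [Finset.filter_le_eq_Ici, Fin.card_Ici]
  rw [← Finset.mul_sum, ← Finset.sum_filter, Finset.sum_const, hcard, nsmul_eq_mul]
  push_cast
  field_simp

namespace Matrix

/-- A signed average of Hermitian contractions is a Hermitian contraction. -/
lemma sum_smul_contraction {ι κ : Type} [Fintype ι] [DecidableEq ι] [Fintype κ]
    {a : κ → ℝ} (ha : ∑ z, |a z| = 1) {B : κ → Matrix ι ι ℂ} (h1 : ∀ z, -1 ≤ B z)
    (h2 : ∀ z, B z ≤ 1) : -1 ≤ ∑ z, a z • B z ∧ ∑ z, a z • B z ≤ 1 := by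
  have key : ∀ z, (|a z| • (1 : Matrix ι ι ℂ) - a z • B z).PosSemidef
      ∧ (a z • B z + |a z| • (1 : Matrix ι ι ℂ)).PosSemidef := fun z => by
    have p1 : (1 - B z).PosSemidef := le_iff.1 (h2 z)
    have p2 : (1 + B z).PosSemidef := by
      have := le_iff.1 (h1 z)
      rwa [sub_neg_eq_add, add_comm] at this
    rcases le_total 0 (a z) with h | h
    · rw [abs_of_nonneg h]
      refine ⟨?_, ?_⟩
      · have := p1.smul h; rwa [smul_sub] at this
      · have := p2.smul h; rwa [smul_add, add_comm] at this
    · rw [abs_of_nonpos h]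
      have h' : 0 ≤ -a z := by linarith
      refine ⟨?_, ?_⟩
      · have := p2.smul h'
        rwa [smul_add, neg_smul _ (B z), ← sub_eq_add_neg] at this
      · have := p1.smul h'
        rwa [smul_sub, neg_smul _ (B z), sub_neg_eq_add, add_comm] at this
  have hone : ∑ z, |a z| • (1 : Matrix ι ι ℂ) = 1 := by rw [← Finset.sum_smul, ha, one_smul]
  constructor
  · rw [le_iff, sub_neg_eq_add, ← hone, ← Finset.sum_add_distrib]
    exact posSemidef_sum _ fun z _ => (key z).2
  · rw [le_iff, ← hone, ← Finset.sum_sub_distrib]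
    exact posSemidef_sum _ fun z _ => (key z).1

end Matrix

/-! ### Block structure of classical-quantum operators -/

/-- The diagonal block of `T` at the classical values `z` and `y`. -/
def diagBlock {Z Y E : Type} (T : Matrix (Z × Y × E) (Z × Y × E) ℂ) (z : Z) (y : Y) :
    Matrix E E ℂ :=
  T.submatrix (fun e => (z, y, e)) (fun e => (z, y, e))

section Block

open Matrix

variable {Z Y E : Type} [Fintype Z] [DecidableEq Z] [Fintype Y] [DecidableEq Y]

lemma trace_mul_proj_kronecker [Fintype E] (T : Matrix (Z × Y × E) (Z × Y × E) ℂ) (z : Z) (y : Y)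
    (P : Matrix E E ℂ) :
    (T * (proj z ⊗ₖ (proj y ⊗ₖ P))).trace = (diagBlock T z y * P).trace := by
  simp only [trace, diag_apply, mul_apply, diagBlock, submatrix_apply, Fintype.sum_prod_type,
    kroneckerMap_apply, proj, single_apply]
  rw [Finset.sum_eq_single z, Finset.sum_eq_single y]
  · refine Finset.sum_congr rfl fun e _ => ?_
    rw [Finset.sum_eq_single z, Finset.sum_eq_single y]
    · simp
    · intro b _ hb; simp [hb.symm]
    · simp
    · intro b _ hb; simp [hb.symm]
    · simp
  · intro b _ hb; simp [hb.symm]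
  · simp
  · intro b _ hb; simp [hb.symm]
  · simp

lemma sum_proj_eq_one {ι : Type} [Fintype ι] [DecidableEq ι] :
    ∑ i : ι, proj i = (1 : Matrix ι ι ℂ) := by
  ext a b
  simp [proj, Matrix.sum_apply, single_apply, one_apply, ite_and]

lemma mixedState_kronecker (P : Matrix E E ℂ) :
    mixedState Z ⊗ₖ (mixedState Y ⊗ₖ P)
      = ∑ z : Z, ∑ y : Y, ((Fintype.card Z : ℝ)⁻¹ * (Fintype.card Y : ℝ)⁻¹) •
          (proj z ⊗ₖ (proj y ⊗ₖ P)) := by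
  ext ⟨z, y, e⟩ ⟨z', y', e'⟩
  simp only [mixedState, ← sum_proj_eq_one, kroneckerMap_apply, Matrix.smul_apply, Matrix.sum_apply,
    Finset.smul_sum, Finset.sum_mul, Finset.mul_sum, Complex.real_smul]
  rw [Finset.sum_comm]
  refine Finset.sum_congr rfl fun _ _ => ?_
  refine Finset.sum_congr rfl fun _ _ => ?_
  push_cast
  ring

end Block

open Matrix in
lemma isHermitian_proj_kronecker {Z Y E : Type} [DecidableEq Z] [DecidableEq Y] (z : Z) (y : Y)
    {P : Matrix E E ℂ} (hP : P.IsHermitian) : (proj z ⊗ₖ (proj y ⊗ₖ P)).IsHermitian := by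
  simp [IsHermitian, conjTranspose_kronecker, proj, conjTranspose_single, hP.eq]

section Extracted

open Matrix

variable {n d : ℕ} {Z E : Type} [Fintype Z] [DecidableEq Z]

lemma isHermitian_extractedState_sub (Ext : Bits n → Bits d → Z) {ρ : Bits n → Matrix E E ℂ}
    (hρ : ∀ x, (ρ x).IsHermitian) :
    (extractedState Ext ρ - mixedState Z ⊗ₖ (mixedState (Bits d) ⊗ₖ ∑ x, ρ x)).IsHermitian := by
  have hsum : (∑ x, ρ x).IsHermitian := by
    rw [IsHermitian, conjTranspose_sum]
    exact Finset.sum_congr rfl fun x _ => hρ x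
  refine IsHermitian.sub ?_ ?_
  · rw [extractedState, IsHermitian, conjTranspose_sum]
    refine Finset.sum_congr rfl fun x _ => ?_
    rw [conjTranspose_sum]
    refine Finset.sum_congr rfl fun y _ => ?_
    rw [conjTranspose_smul, (isHermitian_proj_kronecker _ _ (hρ x)).eq, star_trivial]
  · rw [mixedState_kronecker, IsHermitian, conjTranspose_sum]
    refine Finset.sum_congr rfl fun z _ => ?_
    rw [conjTranspose_sum]
    refine Finset.sum_congr rfl fun y _ => ?_
    rw [conjTranspose_smul, (isHermitian_proj_kronecker _ _ hsum).eq, star_trivial]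

/-- Both operators are block diagonal in the classical registers, so only the diagonal blocks of `T`
contribute. -/
lemma re_trace_mul_extractedState_sub [Fintype E] (Ext : Bits n → Bits d → Z) (ρ : Bits n → Matrix E E ℂ)
    (T : Matrix (Z × Bits d × E) (Z × Bits d × E) ℂ) :
    (T * (extractedState Ext ρ
        - mixedState Z ⊗ₖ (mixedState (Bits d) ⊗ₖ ∑ x, ρ x))).trace.re
      = 1 / 2 ^ d * ∑ y, ∑ x, ∑ z, ((if Ext x y = z then 1 else 0) - 1 / (Fintype.card Z : ℝ))
          * (diagBlock T z y * ρ x).trace.re := by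
  have h1 : (T * extractedState Ext ρ).trace.re
      = 1 / 2 ^ d * ∑ y, ∑ x, (diagBlock T (Ext x y) y * ρ x).trace.re := by
    simp only [extractedState, Finset.mul_sum, trace_sum, Complex.re_sum, mul_smul_comm,
      trace_smul, Complex.smul_re, trace_mul_proj_kronecker, smul_eq_mul]
    exact Finset.sum_comm
  have h2 : (T * (mixedState Z ⊗ₖ (mixedState (Bits d) ⊗ₖ ∑ x, ρ x))).trace.re
      = 1 / 2 ^ d * ∑ y, ∑ x, ∑ z, 1 / (Fintype.card Z : ℝ)
          * (diagBlock T z y * ρ x).trace.re := by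
    rw [mixedState_kronecker]
    simp only [Finset.mul_sum, trace_sum, Complex.re_sum, mul_smul_comm,
      trace_smul, Complex.smul_re, trace_mul_proj_kronecker, smul_eq_mul]
    rw [Finset.sum_comm]
    refine Finset.sum_congr rfl fun y _ => ?_
    rw [Finset.sum_comm]
    refine Finset.sum_congr rfl fun x _ => Finset.sum_congr rfl fun z _ => ?_
    simp only [Fintype.card_pi_const, Fintype.card_bool]
    push_cast
    ring
  rw [mul_sub, trace_sub, Complex.sub_re, h1, h2, ← mul_sub, ← Finset.sum_sub_distrib]
  congr 1
  refine Finset.sum_congr rfl fun y _ => ?_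
  rw [← Finset.sum_sub_distrib]
  refine Finset.sum_congr rfl fun x _ => ?_
  simp only [sub_mul, Finset.sum_sub_distrib, ite_mul, one_mul, zero_mul, Finset.sum_ite_eq,
    Finset.mem_univ, if_true]

end Extracted

/-- The observable for the `i`-th hybrid: it predicts the `i`-th output bit from the preceding
output bits `u j`, `j < i`, and the seed. -/
def hybridObservable {m d : ℕ} {E : Type}
    (T : Matrix (Bits m × Bits d × E) (Bits m × Bits d × E) ℂ) (i : Fin m) (u : Bits m)
    (y : Bits d) : Matrix E E ℂ :=
  ∑ z : Bits m, ((1 / 2 ^ (m - i : ℕ)) * (if ∀ j < i, u j = z j then 1 else 0)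
    * boolSign (z i) : ℝ) • diagBlock T z y

section Hybrid

open Matrix

variable {m d : ℕ} {E : Type}

/-- Allows the true output string to be replaced by one rebuilt from the advice, which is correct
only before position `i`. -/
lemma hybridObservable_congr (T : Matrix (Bits m × Bits d × E) (Bits m × Bits d × E) ℂ)
    (i : Fin m) {u u' : Bits m} (h : ∀ j < i, u j = u' j) (y : Bits d) :
    hybridObservable T i u y = hybridObservable T i u' y := by
  refine Finset.sum_congr rfl fun z _ => ?_
  have : (∀ j < i, u j = z j) ↔ ∀ j < i, u' j = z j :=
    forall₂_congr fun j hj => by rw [h j hj]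
  simp only [this]

variable [DecidableEq E]

lemma diagBlock_contraction {Z Y : Type} [Fintype Z] [DecidableEq Z] [Fintype Y] [DecidableEq Y]
    {T : Matrix (Z × Y × E) (Z × Y × E) ℂ} (h1 : -1 ≤ T) (h2 : T ≤ 1) (z : Z) (y : Y) :
    -1 ≤ diagBlock T z y ∧ diagBlock T z y ≤ 1 := by
  have hone : (1 : Matrix (Z × Y × E) (Z × Y × E) ℂ).submatrix
      (fun e => (z, y, e)) (fun e => (z, y, e)) = (1 : Matrix E E ℂ) :=
    submatrix_one _ fun a b h => by simpa using h
  constructor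
  · have := (le_iff.1 h1).submatrix fun e => (z, y, e)
    rw [le_iff, sub_neg_eq_add, ← hone]
    rwa [sub_neg_eq_add] at this
  · have := (le_iff.1 h2).submatrix fun e => (z, y, e)
    rw [le_iff, ← hone]
    exact this

variable [Fintype E]

lemma hybridObservable_contraction {T : Matrix (Bits m × Bits d × E) (Bits m × Bits d × E) ℂ}
    (h1 : -1 ≤ T) (h2 : T ≤ 1) (i : Fin m) (u : Bits m) (y : Bits d) :
    -1 ≤ hybridObservable T i u y ∧ hybridObservable T i u y ≤ 1 := by
  refine sum_smul_contraction ?_ (fun z => (diagBlock_contraction h1 h2 z y).1)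
    fun z => (diagBlock_contraction h1 h2 z y).2
  refine Eq.trans ?_ (sum_prefix_indicator i u)
  refine Finset.sum_congr rfl fun z _ => ?_
  have h0 : (0 : ℝ) ≤ if ∀ j < i, u j = z j then 1 else 0 := by split_ifs <;> norm_num
  rw [abs_mul, abs_boolSign, mul_one, abs_of_nonneg (mul_nonneg (by positivity) h0)]

/-- The hybrid argument. -/
lemma re_trace_mul_extractedState_sub_eq_hybrid {n : ℕ} (Ext : Bits n → Bits d → Bits m)
    (ρ : Bits n → Matrix E E ℂ) (T : Matrix (Bits m × Bits d × E) (Bits m × Bits d × E) ℂ) :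
    (T * (extractedState Ext ρ
        - mixedState (Bits m) ⊗ₖ (mixedState (Bits d) ⊗ₖ ∑ x, ρ x))).trace.re
      = 1 / 2 ^ d * ∑ i, ∑ y, ∑ x,
          boolSign (Ext x y i) * (hybridObservable T i (Ext x y) y * ρ x).trace.re := by
  rw [re_trace_mul_extractedState_sub]
  congr 1
  rw [Finset.sum_comm (γ := Fin m)]
  refine Finset.sum_congr rfl fun y _ => ?_
  rw [Finset.sum_comm (γ := Fin m)]
  refine Finset.sum_congr rfl fun x _ => ?_
  have hcard : (Fintype.card (Bits m) : ℝ) = 2 ^ m := by simp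
  simp only [hcard, indicator_sub_uniform_eq_sum, Finset.sum_mul, hybridObservable,
    trace_sum, Complex.re_sum, smul_mul_assoc, trace_smul, Complex.smul_re, smul_eq_mul,
    Finset.mul_sum]
  rw [Finset.sum_comm]
  refine Finset.sum_congr rfl fun i _ => Finset.sum_congr rfl fun z _ => ?_
  ring

end Hybrid

/-! ### Splitting the seed -/

/-- Assemble a seed from its bits in `S` and its bits outside `S`. -/
def mergeBits {d t : ℕ} (S : Finset (Fin d)) (h : S.card = t) :
    Bits t × ({k : Fin d // k ∉ S} → Bool) ≃ Bits d :=
  ((Equiv.arrowCongr (S.orderIsoOfFin h).toEquiv (Equiv.refl Bool)).prodCongr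
    (Equiv.refl _)).trans (Equiv.piEquivPiSubtypeProd (· ∈ S) (fun _ => Bool)).symm

lemma mergeBits_apply_notMem {d t : ℕ} {S : Finset (Fin d)} (h : S.card = t) (v : Bits t)
    (w : {k : Fin d // k ∉ S} → Bool) {k : Fin d} (hk : k ∉ S) :
    mergeBits S h (v, w) k = w ⟨k, hk⟩ := by
  simp [mergeBits, Equiv.piEquivPiSubtypeProd, hk]

lemma substring_mergeBits {d t : ℕ} {S : Finset (Fin d)} (h : S.card = t) (v : Bits t)
    (w : {k : Fin d // k ∉ S} → Bool) : substring (mergeBits S h (v, w)) S h = v := by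
  funext i
  have hk : S.orderEmbOfFin h i ∈ S := S.orderEmbOfFin_mem h i
  have : (S.orderIsoOfFin h).symm ⟨S.orderEmbOfFin h i, hk⟩ = i := by
    rw [OrderIso.symm_apply_eq]; rfl
  simp [substring, mergeBits, Equiv.piEquivPiSubtypeProd, this]

lemma substring_congr {d t : ℕ} {y y' : Bits d} {S : Finset (Fin d)} (h : S.card = t)
    (hy : ∀ k ∈ S, y k = y' k) : substring y S h = substring y' S h :=
  funext fun i => hy _ (S.orderEmbOfFin_mem h i)

/-! ### Security of the construction -/

section Security

open Matrix

variable {n m d t : ℕ} {E : Type} [Fintype E] [DecidableEq E]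

/-- The truth tables of the output bits preceding the `i`-th one, as functions of the seed bits
they share with the `i`-th one. -/
abbrev Advice (S : Fin m → Finset (Fin d)) (i : Fin m) : Type :=
  (j : {j // j ∈ Finset.Iio i}) → ({k // k ∈ S j ∩ S i} → Bool) → Bool

lemma card_advice_le {S : Fin m → Finset (Fin d)} (hS : IsWeakDesign t 1 S) (i : Fin m) :
    (Fintype.card (Advice S i) : ℝ) ≤ 2 ^ m := by
  have h : Fintype.card (Advice S i) = 2 ^ ∑ j ∈ Finset.Iio i, 2 ^ (S j ∩ S i).card := by
    rw [Fintype.card_pi, ← Finset.prod_pow_eq_pow_sum, ← Finset.prod_coe_sort (Finset.Iio i)]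
    refine Finset.prod_congr rfl fun j _ => ?_
    simp only [Fintype.card_fun, Fintype.card_bool, Fintype.card_coe]
  have h2 := hS.overlap i
  have h3 : ∑ j ∈ Finset.Iio i, 2 ^ (S j ∩ S i).card ≤ m := by
    rw [one_mul] at h2
    exact_mod_cast h2
  rw [h]
  exact_mod_cast Nat.pow_le_pow_right two_pos h3

/-- Each hybrid of Trevisan's construction has small bias. -/
lemma hybrid_bias_le {C : Bits n → Bits t → Bool} {k δ : ℝ} (hC : IsStrongExtractor k δ C)
    (hδ : 0 < δ) {ρ : Bits n → Matrix E E ℂ} (hρ : ∀ x, (ρ x).PosSemidef)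
    (htr : ∑ x, (ρ x).trace = 1) {σ : Matrix E E ℂ} (hσ : IsState σ) {c : ℝ} (hc : 0 ≤ c)
    (hρσ : ∀ x, ρ x ≤ c • σ) (hcδ : (2 : ℝ) ^ k * c * 2 ^ m ≤ δ)
    {S : Fin m → Finset (Fin d)} (hS : IsWeakDesign t 1 S)
    {T : Matrix (Bits m × Bits d × E) (Bits m × Bits d × E) ℂ} (h1 : -1 ≤ T) (h2 : T ≤ 1)
    (i : Fin m) :
    ∑ y, ∑ x, boolSign (trevisan C S hS.card_eq x y i)
        * (hybridObservable T i (trevisan C S hS.card_eq x y) y * ρ x).trace.re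
      ≤ 2 ^ d * (5 / 2 * √δ) := by
  classical
  set e := mergeBits (S i) (hS.card_eq i) with he
  have hcard : (2 : ℝ) ^ d = Fintype.card ({k : Fin d // k ∉ S i} → Bool) * 2 ^ t := by
    have := Fintype.card_congr e
    rw [Fintype.card_prod, mul_comm, Fintype.card_pi_const, Fintype.card_pi_const,
      Fintype.card_bool] at this
    exact_mod_cast this.symm
  rw [← Equiv.sum_comp e, Fintype.sum_prod_type, Finset.sum_comm, hcard, mul_assoc,
    ← nsmul_eq_mul, ← Finset.card_univ]
  refine Finset.sum_le_card_nsmul _ _ _ fun w _ => ?_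
  -- The string is read only on `S j`, where either the first or the second case holds, so the final
  -- `false` is never used. The one in `U` fills positions from `i` on, which the hybrid observable
  -- ignores.
  set γ : Bits n → Advice S i := fun x j r => C x (substring (fun k =>
    if hk : k ∈ S j ∩ S i then r ⟨k, hk⟩ else if hk' : k ∉ S i then w ⟨k, hk'⟩ else false)
    (S j) (hS.card_eq j)) with hγ
  set U : Advice S i → Bits t → Bits m := fun g v j =>
    if hj : j ∈ Finset.Iio i then g ⟨j, hj⟩ fun k => e (v, w) k else false with hU
  have hagree : ∀ x v, ∀ j < i, U (γ x) v j = trevisan C S hS.card_eq x (e (v, w)) j := by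
    intro x v j hj
    simp only [hU, hγ, Finset.mem_Iio, hj, dif_pos, trevisan]
    congr 1
    refine substring_congr _ fun k hk => ?_
    by_cases hki : k ∈ S i
    · simp [hk, hki]
    · simp [hki, he, mergeBits_apply_notMem]
  have hbit : ∀ x v, trevisan C S hS.card_eq x (e (v, w)) i = C x v := fun x v => by
    simp only [trevisan, he, substring_mergeBits]
  have hmain := hC.quantum_bias_le hδ hρ htr hσ hc hρσ γ
    (le_trans (by gcongr; exact card_advice_le hS i) hcδ)
    (R := fun g v => hybridObservable T i (U g v) (e (v, w)))
    (fun g v => (hybridObservable_contraction h1 h2 i _ _).1)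
    (fun g v => (hybridObservable_contraction h1 h2 i _ _).2)
  refine le_trans (le_of_eq ?_) hmain
  refine Finset.sum_congr rfl fun v _ => Finset.sum_congr rfl fun x _ => ?_
  rw [hbit, hybridObservable_congr T i (hagree x v)]

lemma traceNorm_trevisan_le {C : Bits n → Bits t → Bool} {k δ : ℝ}
    (hC : IsStrongExtractor k δ C)
    (hδ : 0 < δ) {ρ : Bits n → Matrix E E ℂ} (hρ : ∀ x, (ρ x).PosSemidef)
    (htr : ∑ x, (ρ x).trace = 1) {σ : Matrix E E ℂ} (hσ : IsState σ) {c : ℝ} (hc : 0 ≤ c)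
    (hρσ : ∀ x, ρ x ≤ c • σ) (hcδ : (2 : ℝ) ^ k * c * 2 ^ m ≤ δ)
    {S : Fin m → Finset (Fin d)} (hS : IsWeakDesign t 1 S) :
    traceNorm (extractedState (trevisan C S hS.card_eq) ρ
        - mixedState (Bits m) ⊗ₖ (mixedState (Bits d) ⊗ₖ ∑ x, ρ x)) ≤ m * (5 / 2 * √δ) := by
  obtain ⟨T, h1, h2, hT⟩ := exists_contraction_traceNorm
    (isHermitian_extractedState_sub (trevisan C S hS.card_eq) fun x => (hρ x).1)
  rw [hT, re_trace_mul_extractedState_sub_eq_hybrid]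
  calc _ ≤ 1 / 2 ^ d * ∑ _i : Fin m, 2 ^ d * (5 / 2 * √δ) := by
        gcongr with i
        exact hybrid_bias_le hC hδ hρ htr hσ hc hρσ hcδ hS h1 h2 i
    _ = _ := by
        rw [Finset.sum_const, Finset.card_univ, Fintype.card_fin, nsmul_eq_mul]
        field_simp

lemma cqState_submatrix {α β : Type} [Fintype α] [DecidableEq α] (ρ : α → Matrix β β ℂ) (x : α) :
    (cqState ρ).submatrix (fun e => (x, e)) (fun e => (x, e)) = ρ x := by
  ext a b
  rw [submatrix_apply, cqState, Matrix.sum_apply, Finset.sum_eq_single x]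
  · simp [proj]
  · intro z _ hz; simp [proj, hz]
  · simp

/-- An operator with large conditional min-entropy is dominated accordingly. -/
lemma exists_state_of_lt_condMinEntropy {ρ : Bits n → Matrix E E ℂ} {l : ℝ} (hl0 : 0 ≤ l)
    (hl : l < condMinEntropy (cqState ρ)) :
    ∃ σ, IsState σ ∧ ∀ x, ρ x ≤ ((2 : ℝ) ^ (-l)) • σ := by
  rw [condMinEntropy] at hl
  have hne : {l : ℝ | ∃ σ : Matrix E E ℂ, IsState σ ∧
      cqState ρ ≤ ((2 : ℝ) ^ (-l)) • ((1 : Matrix (Bits n) (Bits n) ℂ) ⊗ₖ σ)}.Nonempty := by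
    -- The supremum of the empty set is 0 by convention; `0 ≤ l` excludes this case.
    by_contra h
    rw [Set.not_nonempty_iff_eq_empty] at h
    rw [h, Real.sSup_empty] at hl
    linarith
  obtain ⟨l', ⟨σ, hσ, hle⟩, hl'⟩ := exists_lt_of_lt_csSup hne hl
  refine ⟨σ, hσ, fun x => ?_⟩
  have h1 := (le_iff.1 hle).submatrix fun e => (x, e)
  have h2 : ρ x ≤ ((2 : ℝ) ^ (-l')) • σ := by
    rw [le_iff]
    convert h1 using 1
    ext a b
    have := congrFun₂ (cqState_submatrix ρ x) a b
    rw [submatrix_apply] at this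
    simp [this]
  refine h2.trans ?_
  rw [le_iff, ← sub_smul]
  refine hσ.1.smul (sub_nonneg.2 ?_)
  exact Real.rpow_le_rpow_of_exponent_le one_le_two (by linarith)

end Security

/-- Trevisan's construction, from a one-bit extractor and a weak `(t, 1)`-design. -/
theorem IsStrongExtractor.isQuantumProof_trevisan {n m d t : ℕ} {C : Bits n → Bits t → Bool}
    {k δ : ℝ} (hC : IsStrongExtractor k δ C) (hδ : 0 < δ) {S : Fin m → Finset (Fin d)}
    (hS : IsWeakDesign t 1 S) {k' ε : ℝ} (h0 : 0 ≤ k + m + Real.logb 2 (1 / δ))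
    (hk : k + m + Real.logb 2 (1 / δ) < k') (hε : m * (5 / 4 * √δ) ≤ ε) :
    IsQuantumProofStrongExtractor k' ε (trevisan C S hS.card_eq) := by
  intro E _ _ ρ hρ htr hH
  obtain ⟨σ, hσ, hle⟩ := exists_state_of_lt_condMinEntropy h0 (hk.trans_le hH)
  -- The entropy splits as `k` for the one-bit extractor, `m` for the advice and `log (1 / δ)` as
  -- slack, so the condition on `c` holds with equality.
  have h := traceNorm_trevisan_le hC hδ hρ htr hσ (by positivity) hle (le_of_eq ?_) hS
  · linarith
  · rw [← Real.rpow_natCast 2 m, ← Real.rpow_add two_pos, ← Real.rpow_add two_pos,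
      show k + -(k + m + Real.logb 2 (1 / δ)) + m = Real.logb 2 δ by
        rw [one_div, Real.logb_inv]; ring,
      Real.rpow_logb two_pos (by norm_num) hδ]

/-! ### Existence of weak designs -/

/-- The summand is a product over coordinates, each with one factor 2 and `b - 1` factors 1. Hence a
uniformly random `f` gives the mean `(1 + 1 / b) ^ t`. -/
lemma sum_two_pow_agree {t b : ℕ} (g : Fin t → Fin b) :
    ∑ f : Fin t → Fin b, 2 ^ (Finset.univ.filter fun k => g k = f k).card = (b + 1) ^ t := by
  have h1 : ∀ f : Fin t → Fin b, 2 ^ (Finset.univ.filter fun k => g k = f k).card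
      = ∏ k, if g k = f k then 2 else 1 := fun f => by
    rw [Finset.prod_ite, Finset.prod_const, Finset.prod_const_one, mul_one]
  have h2 : ∀ k, ∑ c, (if g k = c then 2 else 1) = b + 1 := fun k => by
    have : ∀ c, (if g k = c then 2 else 1) = 1 + if g k = c then 1 else 0 := fun c => by
      split_ifs <;> rfl
    simp only [this, Finset.sum_add_distrib, Finset.sum_ite_eq, Finset.mem_univ, if_true]
    simp
  simp only [h1]
  rw [← Fintype.piFinset_univ,
    ← Finset.prod_univ_sum (fun _ => Finset.univ) fun k c => if g k = c then 2 else 1]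
  simp only [h2, Finset.prod_const, Finset.card_univ, Fintype.card_fin]

lemma exists_few_agreements {t b : ℕ} (hb : (b + 1) ^ t ≤ 2 * b ^ t) {κ : Type} (s : Finset κ)
    (g : κ → Fin t → Fin b) :
    ∃ f : Fin t → Fin b,
      ∑ j ∈ s, 2 ^ (Finset.univ.filter fun k => g j k = f k).card ≤ 2 * s.card := by
  have hne : (Finset.univ : Finset (Fin t → Fin b)).Nonempty := by
    rw [← Finset.card_pos, Finset.card_univ, Fintype.card_pi_const, Fintype.card_fin]
    have : 0 < (b + 1) ^ t := by positivity
    omega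
  have hsum : ∑ f : Fin t → Fin b,
      ∑ j ∈ s, 2 ^ (Finset.univ.filter fun k => g j k = f k).card
        ≤ ∑ _f : Fin t → Fin b, 2 * s.card := by
    rw [Finset.sum_comm]
    simp only [sum_two_pow_agree, Finset.sum_const, Finset.card_univ, Fintype.card_pi_const,
      Fintype.card_fin, smul_eq_mul]
    calc s.card * (b + 1) ^ t ≤ s.card * (2 * b ^ t) := Nat.mul_le_mul_left _ hb
      _ = _ := by ring
  obtain ⟨f, -, hf⟩ := Finset.exists_le_of_sum_le hne hsum
  exact ⟨f, hf⟩

lemma exists_seq_few_agreements {t b : ℕ} (hb : (b + 1) ^ t ≤ 2 * b ^ t) (s : ℕ → Finset ℕ)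
    (hs : ∀ i, s i ⊆ Finset.range i) (N : ℕ) :
    ∃ f : ℕ → Fin t → Fin b, ∀ i < N,
      ∑ j ∈ s i, 2 ^ (Finset.univ.filter fun k => f j k = f i k).card ≤ 2 * (s i).card := by
  induction N with
  | zero =>
    obtain ⟨f, -⟩ := exists_few_agreements hb (∅ : Finset (Fin 0)) Fin.elim0
    exact ⟨fun _ => f, fun i hi => absurd hi (Nat.not_lt_zero i)⟩
  | succ N ih =>
    obtain ⟨f, hf⟩ := ih
    obtain ⟨f₀, hf₀⟩ := exists_few_agreements hb (s N) f
    refine ⟨Function.update f N f₀, fun i hi => ?_⟩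
    have hold : ∀ j ∈ s i, Function.update f N f₀ j = f j := fun j hj =>
      Function.update_of_ne (by have := Finset.mem_range.1 (hs i hj); omega) _ _
    rcases Nat.lt_succ_iff_lt_or_eq.1 hi with h | rfl
    · refine le_trans (le_of_eq (Finset.sum_congr rfl fun j hj => ?_)) (hf i h)
      rw [hold j hj, Function.update_of_ne h.ne]
    · refine le_trans (le_of_eq (Finset.sum_congr rfl fun j hj => ?_)) hf₀
      rw [hold j hj, Function.update_self]

/-- `(1 + 1 / b) ^ t ≤ exp (t / b) ≤ 2` as soon as `b ≥ t / ln 2`; this dictates the alphabet size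
in the seed length. -/
lemma succ_ceil_pow_le (t : ℕ) :
    (⌈(t : ℝ) / Real.log 2⌉₊ + 1) ^ t ≤ 2 * ⌈(t : ℝ) / Real.log 2⌉₊ ^ t := by
  rcases Nat.eq_zero_or_pos t with rfl | ht
  · simp
  set b := ⌈(t : ℝ) / Real.log 2⌉₊ with hb
  have hlog : 0 < Real.log 2 := Real.log_pos one_lt_two
  have hle : (t : ℝ) / Real.log 2 ≤ b := Nat.le_ceil _
  have hb0 : (0 : ℝ) < b := lt_of_lt_of_le (by positivity) hle
  have h1 : (1 + 1 / (b : ℝ)) ^ t ≤ 2 := by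
    calc (1 + 1 / (b : ℝ)) ^ t ≤ Real.exp (1 / b) ^ t := by
          gcongr
          rw [add_comm]; exact Real.add_one_le_exp _
      _ = Real.exp (t * (1 / b)) := (Real.exp_nat_mul _ _).symm
      _ ≤ Real.exp (Real.log 2) := by
          rw [Real.exp_le_exp, mul_one_div, div_le_iff₀ hb0, mul_comm, ← div_le_iff₀ hlog]
          exact hle
      _ = 2 := Real.exp_log two_pos
  have h2 : ((b : ℝ) + 1) ^ t ≤ 2 * (b : ℝ) ^ t := by
    calc ((b : ℝ) + 1) ^ t = (1 + 1 / (b : ℝ)) ^ t * (b : ℝ) ^ t := by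
          rw [← mul_pow]; congr 1; field_simp
      _ ≤ _ := by gcongr
  exact_mod_cast h2

lemma natLog_lt_ceil_logb {m r : ℕ} (hr : r ≤ m) (hm : 1 ≤ m) :
    Nat.log 2 r < ⌈Real.logb 2 (4 * m)⌉₊ := by
  refine (Nat.log_mono_right hr).trans_lt ?_
  have hm' : (0 : ℝ) < m := by exact_mod_cast hm
  rw [Nat.lt_ceil, Real.lt_logb_iff_rpow_lt one_lt_two (by positivity), Real.rpow_natCast]
  have : ((2 ^ Nat.log 2 m : ℕ) : ℝ) ≤ m := by
    exact_mod_cast Nat.pow_log_le_self 2 (by omega)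
  push_cast at this
  linarith

/-- The number of earlier indices, with those in the same dyadic block counted twice. -/
lemma add_card_same_block_le {m i : ℕ} (hi : i < m) :
    i + ((Finset.range i).filter fun j => Nat.log 2 (m - j) = Nat.log 2 (m - i)).card ≤ m := by
  set h := Nat.log 2 (m - i) with hh
  have h1 : 2 ^ h ≤ m - i := Nat.pow_log_le_self 2 (by omega)
  -- A block consists of the `j` with `2 ^ h ≤ m - j < 2 ^ (h + 1)`. Blocks shrink towards the end,
  -- leaving room to count block members twice.
  have hsub : ((Finset.range i).filter fun j => Nat.log 2 (m - j) = h)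
      ⊆ Finset.Ico (m + 1 - 2 * 2 ^ h) i := by
    intro j hj
    rw [Finset.mem_filter, Finset.mem_range] at hj
    have h2 : m - j < 2 ^ (Nat.log 2 (m - j) + 1) := Nat.lt_pow_succ_log_self one_lt_two _
    rw [hj.2, pow_succ'] at h2
    rw [Finset.mem_Ico]
    omega
  have := Finset.card_le_card hsub
  rw [Nat.card_Ico] at this
  omega

/-- Existence of weak `(t, 1)`-designs. -/
theorem exists_isWeakDesign (t : ℕ) {m : ℕ} (hm : 1 ≤ m) :
    ∃ S : Fin m → Finset (Fin (seedLength t m)), IsWeakDesign t 1 S := by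
  set L := ⌈Real.logb 2 (4 * m)⌉₊ with hL
  set b := ⌈(t : ℝ) / Real.log 2⌉₊ with hb
  change ∃ S : Fin m → Finset (Fin (t * b * L)), IsWeakDesign t 1 S
  set s : ℕ → Finset ℕ := fun i =>
    (Finset.range i).filter fun j => Nat.log 2 (m - j) = Nat.log 2 (m - i) with hs
  obtain ⟨f, hf⟩ := exists_seq_few_agreements (succ_ceil_pow_le t) s
    (fun i => Finset.filter_subset _ _) m
  have hlt : ∀ i : Fin m, Nat.log 2 (m - i) < L := fun i =>
    natLog_lt_ceil_logb (Nat.sub_le _ _) hm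
  -- The set of `i` is the graph of `f i`, placed in the layer of its dyadic block. Different layers
  -- are disjoint; within a layer, intersections are agreements of functions.
  set p : Fin m → Fin t → Fin (t * b * L) := fun i k =>
    finProdFinEquiv (finProdFinEquiv (k, f i k), ⟨Nat.log 2 (m - i), hlt i⟩) with hp
  have hinj : ∀ i, Function.Injective (p i) := fun i k k' h => by
    simp only [hp, EmbeddingLike.apply_eq_iff_eq, Prod.mk.injEq] at h
    exact h.1.1
  have hmeet : ∀ i j k k', p i k = p j k' →
      k = k' ∧ f i k = f j k' ∧ Nat.log 2 (m - i) = Nat.log 2 (m - j) := fun i j k k' h => by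
    simp only [hp, EmbeddingLike.apply_eq_iff_eq, Prod.mk.injEq, Fin.mk.injEq] at h
    exact ⟨h.1.1, h.1.2, h.2⟩
  refine ⟨fun i => Finset.univ.image (p i), fun i => ?_, fun i => ?_⟩
  · rw [Finset.card_image_of_injective _ (hinj i), Finset.card_univ, Fintype.card_fin]
  · set F : ℕ → ℕ := fun j => if Nat.log 2 (m - j) = Nat.log 2 (m - i) then
      2 ^ (Finset.univ.filter fun k => f j k = f i k).card else 1 with hF
    have hinter : ∀ j, 2 ^ (Finset.univ.image (p j) ∩ Finset.univ.image (p i)).card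
        ≤ F (j : ℕ) := fun j => by
      simp only [hF]
      split_ifs with hji
      · refine Nat.pow_le_pow_right two_pos ?_
        refine le_trans (Finset.card_le_card (t := (Finset.univ.filter
          fun k => f j k = f i k).image (p i)) ?_) Finset.card_image_le
        intro z hz
        simp only [Finset.mem_inter, Finset.mem_image, Finset.mem_univ, true_and] at hz
        obtain ⟨⟨k, rfl⟩, k', hk'⟩ := hz
        obtain ⟨rfl, h2, -⟩ := hmeet _ _ _ _ hk'
        exact Finset.mem_image.2 ⟨k', by simp [h2], hk'⟩
      · rw [Finset.card_eq_zero.2, pow_zero]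
        rw [← Finset.disjoint_iff_inter_eq_empty, Finset.disjoint_left]
        intro z hz hz'
        simp only [Finset.mem_image, Finset.mem_univ, true_and] at hz hz'
        obtain ⟨k, rfl⟩ := hz
        obtain ⟨k', hk'⟩ := hz'
        exact hji (hmeet _ _ _ _ hk').2.2.symm
    have hrange : ∑ j ∈ Finset.Iio i, F (j : ℕ) = ∑ j ∈ Finset.range i, F j := by
      have := Finset.sum_map (Finset.Iio i) Fin.valEmbedding F
      rw [Fin.map_valEmbedding_Iio, Nat.Iio_eq_range] at this
      exact this.symm
    have hbound : ∑ j ∈ Finset.range i, F j ≤ m := by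
      have h1 := hf i i.2
      have h2 := add_card_same_block_le i.2
      have h3 := Finset.card_filter_add_card_filter_not (s := Finset.range (i : ℕ))
        fun j => Nat.log 2 (m - j) = Nat.log 2 (m - i)
      rw [Finset.card_range] at h3
      simp only [hF, Finset.sum_ite, Finset.sum_const, smul_eq_mul, mul_one]
      simp only [hs] at h1
      omega
    have htot : ∑ j ∈ Finset.Iio i,
        2 ^ (Finset.univ.image (p j) ∩ Finset.univ.image (p i)).card ≤ m :=
      (Finset.sum_le_sum fun j _ => hinter j).trans (hrange.trans_le hbound)
    rw [one_mul]
    exact_mod_cast htot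

/-! ### Existence of list-decodable codes -/

/-- Distinct codewords have small correlation. -/
def HasSmallCorrelation {n : ℕ} {ι : Type} [Fintype ι] (code : Bits n → ι → Bool) (γ : ℝ) : Prop :=
  ∀ x x', x ≠ x' → ∑ y, boolSign (code x y) * boolSign (code x' y) ≤ γ * Fintype.card ι

section SmallCorrelation

variable {n : ℕ} {ι : Type} [Fintype ι] {code : Bits n → ι → Bool} {γ : ℝ}

/-- Cauchy-Schwarz over positions, then expansion of the square: the diagonal gives the collision
term, the rest is controlled by the correlations. -/
lemma HasSmallCorrelation.sq_sum_abs_le (h : HasSmallCorrelation code γ) (hγ : 0 ≤ γ)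
    {q : Bits n → ℝ} (hq : ∀ x, 0 ≤ q x) :
    (∑ y, |∑ x, boolSign (code x y) * q x|) ^ 2
      ≤ (Fintype.card ι : ℝ) ^ 2 * (∑ x, q x ^ 2 + γ * (∑ x, q x) ^ 2) := by
  set N : ℝ := (Fintype.card ι : ℝ) with hN
  have h1 : (∑ y, |∑ x, boolSign (code x y) * q x|) ^ 2
      ≤ N * ∑ y, (∑ x, boolSign (code x y) * q x) ^ 2 := by
    have := sq_sum_le_card_mul_sum_sq (s := Finset.univ)
      (f := fun y => |∑ x, boolSign (code x y) * q x|)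
    simpa only [sq_abs, Finset.card_univ] using this
  have h2 : ∀ x x', ∑ y, boolSign (code x y) * boolSign (code x' y)
      ≤ (if x = x' then N else 0) + γ * N := fun x x' => by
    split_ifs with hx
    · subst hx
      simp only [boolSign_mul_self, Finset.sum_const, Finset.card_univ, nsmul_eq_mul, mul_one]
      have : 0 ≤ γ * N := by positivity
      linarith
    · rw [zero_add]; exact h x x' hx
  have h3 : ∑ y, (∑ x, boolSign (code x y) * q x) ^ 2
      = ∑ x, ∑ x', q x * q x' * ∑ y, boolSign (code x y) * boolSign (code x' y) := by
    have : ∀ y, (∑ x, boolSign (code x y) * q x) ^ 2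
        = ∑ x, ∑ x', boolSign (code x y) * q x * (boolSign (code x' y) * q x') := fun y => by
      rw [sq, Finset.sum_mul_sum]
    simp only [this, Finset.mul_sum]
    rw [Finset.sum_comm]
    refine Finset.sum_congr rfl fun x _ => ?_
    rw [Finset.sum_comm]
    refine Finset.sum_congr rfl fun x' _ => Finset.sum_congr rfl fun y _ => ?_
    ring
  calc _ ≤ N * ∑ x, ∑ x', q x * q x' * ((if x = x' then N else 0) + γ * N) := by
        refine h1.trans ?_
        rw [h3]
        gcongr with x _ x' _
        · exact mul_nonneg (hq x) (hq x')
        · exact h2 x x'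
    _ = _ := by
        simp only [mul_add, Finset.sum_add_distrib, mul_ite, mul_zero, Finset.sum_ite_eq,
          Finset.mem_univ, if_true]
        simp only [← Finset.sum_mul, ← Finset.mul_sum, sq]
        ring

/-- The Johnson bound. -/
lemma HasSmallCorrelation.isListDecodable [Nonempty ι] {η : ℝ} (h : HasSmallCorrelation code γ)
    (hγ : 0 ≤ γ) (hη : 0 < η) (hγη : γ ≤ 3 * η ^ 2) : IsListDecodable code η (1 / η ^ 2) := by
  classical
  intro w
  set A : Finset (Bits n) :=
    {x : Bits n | (hammingDist (code x) w : ℝ) ≤ (1 / 2 - η) * Fintype.card ι} with hA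
  set N : ℝ := (Fintype.card ι : ℝ) with hN
  have hN0 : 0 < N := by rw [hN]; exact_mod_cast Fintype.card_pos
  set a : ℝ := (A.card : ℝ) with ha
  set q : Bits n → ℝ := fun x => if x ∈ A then 1 else 0 with hq
  have hq0 : ∀ x, 0 ≤ q x := fun x => by simp only [hq]; split_ifs <;> norm_num
  have hqs : ∑ x, q x = a := by simp [hq, ha]
  have hqs2 : ∑ x, q x ^ 2 = a := by simp [hq, ha]
  have hcorr : ∀ x ∈ A, 2 * η * N ≤ ∑ y, boolSign (w y) * boolSign (code x y) := fun x hx => by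
    have h1 : (hammingDist (code x) w : ℝ) ≤ (1 / 2 - η) * N := by
      simpa [hA] using hx
    have h2 : ∑ y, boolSign (w y) * boolSign (code x y) = N - 2 * hammingDist (code x) w := by
      have : ∀ y, boolSign (w y) * boolSign (code x y)
          = 1 - 2 * if code x y ≠ w y then 1 else 0 := fun y => by
        cases w y <;> cases code x y <;> norm_num [boolSign]
      simp only [this, Finset.sum_sub_distrib, ← Finset.mul_sum, Finset.sum_boole, hammingDist]
      simp [hN]
    rw [h2]; linarith
  have hlow : 2 * η * N * a ≤ ∑ y, |∑ x, boolSign (code x y) * q x| := by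
    calc 2 * η * N * a = ∑ x ∈ A, 2 * η * N := by
          rw [Finset.sum_const, nsmul_eq_mul]; ring
      _ ≤ ∑ x ∈ A, ∑ y, boolSign (w y) * boolSign (code x y) := Finset.sum_le_sum hcorr
      _ = ∑ y, boolSign (w y) * ∑ x, boolSign (code x y) * q x := by
          rw [Finset.sum_comm]
          refine Finset.sum_congr rfl fun y _ => ?_
          simp [hq, Finset.mul_sum]
      _ ≤ _ := by
          refine Finset.sum_le_sum fun y _ => (le_abs_self _).trans ?_
          rw [abs_mul, abs_boolSign, one_mul]
  have hsq := h.sq_sum_abs_le hγ hq0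
  rw [hqs, hqs2] at hsq
  have hpow := pow_le_pow_left₀ (by positivity) hlow 2
  have hmain : N ^ 2 * (4 * η ^ 2 * a ^ 2) ≤ N ^ 2 * (a + γ * a ^ 2) := by
    refine le_trans (le_of_eq ?_) (hpow.trans hsq)
    ring
  have hmain2 := le_of_mul_le_mul_left hmain (by positivity)
  have ha0 : 0 ≤ a := by positivity
  -- From `4 η² a² ≤ a + γ a²`; `γ ≤ 3 η²` leaves `η² a² ≤ a`.
  have h4 : a * (η ^ 2 * a) ≤ a * 1 := by nlinarith [mul_le_mul_of_nonneg_right hγη (sq_nonneg a)]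
  rw [le_div_iff₀ (by positivity)]
  rcases ha0.eq_or_lt with h0 | h0
  · rw [← h0]; norm_num
  · have := le_of_mul_le_mul_left h4 h0
    linarith

/-- As in the leftover hash lemma, min-entropy enters only through the collision probability, at
most `2 ^ (-k)`. -/
lemma HasSmallCorrelation.isStrongExtractor {t : ℕ} {C : Bits n → Bits t → Bool} {k δ : ℝ}
    (h : HasSmallCorrelation C γ) (hγ : 0 ≤ γ) (hδ : 0 ≤ δ)
    (hk : (2 : ℝ) ^ (-k) + γ ≤ 4 * δ ^ 2) : IsStrongExtractor k δ C := by
  intro p hp hkp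
  rw [le_minEntropy_iff hp] at hkp
  rw [sum_dist_bool_eq C hp.2]
  have hsq := h.sq_sum_abs_le hγ hp.1
  have h2 : ∑ x, p x ^ 2 ≤ (2 : ℝ) ^ (-k) := by
    calc _ ≤ ∑ x, (2 : ℝ) ^ (-k) * p x := Finset.sum_le_sum fun x _ => by
          rw [sq]; exact mul_le_mul_of_nonneg_right (hkp x) (hp.1 x)
      _ = _ := by rw [← Finset.mul_sum, hp.2, mul_one]
  rw [hp.2, one_pow, mul_one, Fintype.card_pi_const, Fintype.card_bool] at hsq
  have h3 : (∑ y, |∑ x, boolSign (C x y) * p x|) ^ 2 ≤ (2 ^ t * (2 * δ)) ^ 2 := by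
    refine hsq.trans ?_
    rw [mul_pow]
    push_cast
    gcongr
    nlinarith
  have h4 := (abs_le_of_sq_le_sq' h3 (by positivity)).2
  calc _ ≤ 1 / 2 * (1 / 2 ^ t * (2 ^ t * (2 * δ))) := by gcongr
    _ = δ := by field_simp

end SmallCorrelation

/-- A bit of `ZMod 2` as a Boolean. -/
def zmodBit (a : ZMod 2) : Bool := decide (a = 1)

lemma boolSign_zmodBit_mul (a b : ZMod 2) :
    boolSign (zmodBit a) * boolSign (zmodBit b) = boolSign (zmodBit (a + b)) := by
  have h : ∀ a b : ZMod 2, zmodBit (a + b) = xor (zmodBit a) (zmodBit b) := by decide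
  rw [h]
  cases zmodBit a <;> cases zmodBit b <;> simp [boolSign]

/-- Orthogonality of the characters of `𝔽₂ˢ`. -/
lemma sum_boolSign_dotProduct {s : ℕ} (u : Fin s → ZMod 2) :
    ∑ β : Fin s → ZMod 2, boolSign (zmodBit (u ⬝ᵥ β)) = if u = 0 then 2 ^ s else 0 := by
  split_ifs with hu
  · subst hu
    simp [zmodBit, boolSign]
  · obtain ⟨i, hi⟩ := Function.ne_iff.1 hu
    have hi1 : u i = 1 := by
      have : ∀ a : ZMod 2, a ≠ 0 → a = 1 := by decide
      exact this _ hi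
    have h1 := Equiv.sum_comp (Equiv.addRight (Pi.single i (1 : ZMod 2)))
      fun β : Fin s → ZMod 2 => boolSign (zmodBit (u ⬝ᵥ β))
    have h2 : ∀ β, boolSign (zmodBit (u ⬝ᵥ (β + Pi.single i 1)))
        = -boolSign (zmodBit (u ⬝ᵥ β)) := fun β => by
      rw [dotProduct_add, dotProduct_single, hi1, one_mul, ← boolSign_zmodBit_mul]
      simp [zmodBit, boolSign]
    simp only [Equiv.coe_addRight, h2, Finset.sum_neg_distrib] at h1
    linarith

/-- Polynomials over a field of order `2 ^ s`, concatenated with the Hadamard code. -/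
lemma exists_code_smallCorrelation (n : ℕ) {s : ℕ} (hs : s ≠ 0) :
    ∃ C : Bits n → Bits (s + s) → Bool, HasSmallCorrelation C (n / 2 ^ s) := by
  classical
  let F := GaloisField 2 s
  have : Fintype F := Fintype.ofFinite F
  have hF : Fintype.card F = 2 ^ s := by
    rw [← Nat.card_eq_fintype_card]; exact GaloisField.card 2 s hs
  have hfr : Module.finrank (ZMod 2) F = Module.finrank (ZMod 2) (Fin s → ZMod 2) := by
    rw [GaloisField.finrank 2 hs, Module.finrank_fin_fun]
  let φ : F ≃ₗ[ZMod 2] (Fin s → ZMod 2) := LinearEquiv.ofFinrankEq _ _ hfr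
  have hcard : Fintype.card (Bits (s + s)) = Fintype.card (F × (Fin s → ZMod 2)) := by
    rw [Fintype.card_prod, hF]
    simp [pow_add, ZMod.card]
  let e : Bits (s + s) ≃ F × (Fin s → ZMod 2) := Fintype.equivOfCardEq hcard
  let P : Bits n → Polynomial F := fun x => Polynomial.ofFn n fun i => if x i then 1 else 0
  refine ⟨fun x y => zmodBit (φ ((P x).eval (e y).1) ⬝ᵥ (e y).2), fun x x' hne => ?_⟩
  have hcoef : ∀ (x : Bits n) (i : Fin n), (P x).coeff i = if x i then 1 else 0 := fun x i => by
    simp [P, Polynomial.ofFn_coeff_eq_val_of_lt]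
  have hsub : P x - P x' ≠ 0 := fun h => hne <| funext fun i => by
    have h1 := congrArg (fun p => Polynomial.coeff p i) (sub_eq_zero.1 h)
    simp only [hcoef] at h1
    cases hx : x i <;> cases hx' : x' i <;> simp_all
  have hdeg : (P x - P x').natDegree ≤ n := by
    refine Polynomial.natDegree_le_of_degree_le (le_trans (Polynomial.degree_sub_le _ _) ?_)
    exact max_le (Polynomial.ofFn_degree_lt _).le (Polynomial.ofFn_degree_lt _).le
  -- In characteristic 2 these are the roots of `P x - P x'`. Elsewhere the Hadamard characters
  -- cancel, so only `Z` contributes to the correlation.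
  set Z : Finset F := Finset.univ.filter fun α => (P x).eval α + (P x').eval α = 0 with hZ
  have hZcard : Z.card ≤ n := by
    refine le_trans (Polynomial.card_le_degree_of_subset_roots (p := P x - P x') ?_) hdeg
    intro α hα
    rw [Finset.mem_val, hZ, Finset.mem_filter] at hα
    rw [Polynomial.mem_roots hsub, Polynomial.IsRoot, Polynomial.eval_sub, CharTwo.sub_eq_add]
    exact hα.2
  have hsum : ∑ y, boolSign (zmodBit (φ ((P x).eval (e y).1) ⬝ᵥ (e y).2))
      * boolSign (zmodBit (φ ((P x').eval (e y).1) ⬝ᵥ (e y).2)) = Z.card * 2 ^ s := by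
    rw [Equiv.sum_comp e fun z => boolSign (zmodBit (φ ((P x).eval z.1) ⬝ᵥ z.2))
      * boolSign (zmodBit (φ ((P x').eval z.1) ⬝ᵥ z.2)), Fintype.sum_prod_type]
    simp only [boolSign_zmodBit_mul, ← add_dotProduct, ← map_add, sum_boolSign_dotProduct,
      EmbeddingLike.map_eq_zero_iff]
    rw [← Finset.sum_filter, Finset.sum_const, nsmul_eq_mul]
  rw [hsum, Fintype.card_pi_const, Fintype.card_bool]
  push_cast
  rw [pow_add, div_mul_eq_mul_div, ← mul_assoc, mul_div_assoc, div_self (by positivity), mul_one]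
  gcongr

/-! ### Parameters -/

lemma logb_div_eq {x y : ℝ} (hx : 0 < x) (hy : 0 < y) :
    Real.logb 2 (x / y) = Real.logb 2 x + Real.logb 2 (1 / y) := by
  rw [Real.logb_div hx.ne' hy.ne', one_div, Real.logb_inv, sub_eq_add_neg]

lemma one_le_logb_div {n : ℕ} (hn : 1 ≤ n) {δ : ℝ} (hδ0 : 0 < δ) (hδ : δ ≤ 1 / 9) :
    1 ≤ Real.logb 2 (1 / δ) ∧ 0 ≤ Real.logb 2 n := by
  have hn' : (1 : ℝ) ≤ n := by exact_mod_cast hn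
  refine ⟨?_, Real.logb_nonneg one_lt_two hn'⟩
  rw [Real.le_logb_iff_rpow_le one_lt_two (by positivity), Real.rpow_one, le_div_iff₀ hδ0]
  linarith

/-- List-decodable codes of polynomial length that are one-bit extractors. -/
theorem exists_listDecodable_strongExtractor {n : ℕ} (hn : 1 ≤ n) {δ : ℝ} (hδ0 : 0 < δ)
    (hδ : δ ≤ 1 / 9) :
    ∃ (t : ℕ) (C : Bits n → Bits t → Bool), (t : ℝ) ≤ 8 * Real.logb 2 (n / δ) ∧
      IsListDecodable C (δ / 2) (1 / (δ / 2) ^ 2) ∧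
      IsStrongExtractor (3 * Real.logb 2 (1 / δ)) δ C := by
  have hn' : (1 : ℝ) ≤ n := by exact_mod_cast hn
  obtain ⟨hl1, hl2⟩ := one_le_logb_div hn hδ0 hδ
  have hlog : Real.logb 2 (2 * n / δ ^ 2) = 1 + Real.logb 2 n + 2 * Real.logb 2 (1 / δ) := by
    rw [logb_div_eq (by positivity) (by positivity), Real.logb_mul (by norm_num) (by positivity),
      Real.logb_self_eq_one one_lt_two, one_div, one_div, ← inv_pow, Real.logb_pow]
    push_cast
    ring
  -- Chosen to make the correlation `n / 2 ^ s` at most `δ² / 2`, below both `3 (δ / 2)²` for list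
  -- decoding and `4 δ² - δ³` for extraction.
  set s := ⌈Real.logb 2 (2 * n / δ ^ 2)⌉₊ with hs
  have hs0 : s ≠ 0 := by
    have : 0 < s := by rw [hs, Nat.ceil_pos, hlog]; linarith
    omega
  obtain ⟨C, hC⟩ := exists_code_smallCorrelation n hs0
  have hpow : 2 * n / δ ^ 2 ≤ (2 : ℝ) ^ s := by
    rw [← Real.rpow_natCast 2 s, ← Real.logb_le_iff_le_rpow one_lt_two (by positivity)]
    exact Nat.le_ceil _
  have hγ0 : (0 : ℝ) ≤ n / 2 ^ s := by positivity
  have hγ : (n : ℝ) / 2 ^ s ≤ δ ^ 2 / 2 := by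
    rw [div_le_iff₀ (by positivity)] at hpow ⊢
    linarith
  refine ⟨s + s, C, ?_, hC.isListDecodable hγ0 (by positivity) ?_,
    hC.isStrongExtractor hγ0 hδ0.le ?_⟩
  · have h1 : (s : ℝ) < Real.logb 2 (2 * n / δ ^ 2) + 1 :=
      Nat.ceil_lt_add_one (by rw [hlog]; linarith)
    rw [hlog] at h1
    rw [logb_div_eq (by positivity) hδ0]
    push_cast
    linarith
  · refine hγ.trans ?_
    nlinarith [sq_nonneg δ]
  · have h1 : (2 : ℝ) ^ (-(3 * Real.logb 2 (1 / δ))) = δ ^ 3 := by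
      rw [one_div, Real.logb_inv, mul_neg, neg_neg, mul_comm, Real.rpow_mul two_pos.le,
        Real.rpow_logb two_pos (by norm_num) hδ0]
      norm_cast
    rw [h1]
    have : δ ^ 3 ≤ δ ^ 2 := pow_le_pow_of_le_one hδ0.le (by linarith) (by norm_num)
    nlinarith [sq_nonneg δ]

lemma seedLength_le (t : ℕ) {m : ℕ} (hm : 2 ≤ m) :
    (seedLength t m : ℝ) ≤ 4 * (1 / Real.log 2 + 1) * (t : ℝ) ^ 2 * Real.logb 2 m := by
  have hlog : 0 < Real.log 2 := Real.log_pos one_lt_two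
  have hm' : (2 : ℝ) ≤ m := by exact_mod_cast hm
  have hlm : 1 ≤ Real.logb 2 m := by
    rw [Real.le_logb_iff_rpow_le one_lt_two (by linarith), Real.rpow_one]; exact hm'
  rw [seedLength]
  rcases Nat.eq_zero_or_pos t with rfl | ht
  · simp
  have ht' : (1 : ℝ) ≤ t := by exact_mod_cast ht
  have h1 : (⌈(t : ℝ) / Real.log 2⌉₊ : ℝ) ≤ (1 / Real.log 2 + 1) * t := by
    have := (Nat.ceil_lt_add_one (a := (t : ℝ) / Real.log 2) (by positivity)).le
    have e : (1 / Real.log 2 + 1) * (t : ℝ) = t / Real.log 2 + t := by ring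
    linarith
  have h2 : (⌈Real.logb 2 (4 * m)⌉₊ : ℝ) ≤ 4 * Real.logb 2 m := by
    have e : Real.logb 2 (4 * m) = 2 + Real.logb 2 m := by
      rw [Real.logb_mul (by norm_num) (by linarith), show (4 : ℝ) = 2 ^ 2 by norm_num,
        Real.logb_pow, Real.logb_self_eq_one one_lt_two]
      norm_num
    have := (Nat.ceil_lt_add_one (a := Real.logb 2 (4 * m)) (by rw [e]; linarith)).le
    linarith
  push_cast
  calc _ ≤ (t : ℝ) * ((1 / Real.log 2 + 1) * t) * (4 * Real.logb 2 m) := by gcongr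
    _ = _ := by ring

/-- With `x = n / ε ≥ 2`, the argument is at most `9 x³`, and `9 ≤ x⁴`. -/
lemma logb_div_le {n m : ℕ} {ε : ℝ} (hm : 2 ≤ m) (hmn : m ≤ n) (hε0 : 0 < ε) (hε : ε ≤ 1) :
    Real.logb 2 (n / (ε ^ 2 / (9 * (m : ℝ) ^ 2))) ≤ 7 * Real.logb 2 (n / ε) := by
  have hm' : (2 : ℝ) ≤ m := by exact_mod_cast hm
  have hmn' : (m : ℝ) ≤ n := by exact_mod_cast hmn
  have hn0 : (0 : ℝ) < n := by linarith
  have hx : 2 ≤ (n : ℝ) / ε := by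
    rw [le_div_iff₀ hε0]; nlinarith
  set x : ℝ := n / ε with hxdef
  have hnx : (n : ℝ) = x * ε := by rw [hxdef]; field_simp
  have hle : n / (ε ^ 2 / (9 * (m : ℝ) ^ 2)) ≤ x ^ 7 := by
    calc (n : ℝ) / (ε ^ 2 / (9 * (m : ℝ) ^ 2)) = 9 * n * m ^ 2 / ε ^ 2 := by field_simp
      _ ≤ 9 * (x * ε) * (x * ε) ^ 2 / ε ^ 2 := by rw [← hnx]; gcongr
      _ = 9 * x ^ 3 * ε := by field_simp
      _ ≤ 9 * x ^ 3 * 1 := by gcongr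
      _ ≤ x ^ 4 * x ^ 3 := by
        have : (2 : ℝ) ^ 4 ≤ x ^ 4 := by gcongr
        have h3 : 0 ≤ x ^ 3 := by positivity
        nlinarith
      _ = x ^ 7 := by ring
  calc _ ≤ Real.logb 2 (x ^ 7) :=
        Real.logb_le_logb_of_le one_lt_two (by positivity) hle
    _ = _ := by rw [Real.logb_pow]; norm_num

end

theorem mainTheorem4 :
    ∃ a K c : ℝ, 0 < a ∧ 0 < K ∧ 0 < c ∧
      ∀ (n m : ℕ) (ε δ : ℝ), 1 ≤ n → 1 ≤ m → 0 < ε → ε ≤ 1 → δ = ε ^ 2 / (9 * (m : ℝ) ^ 2) →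
        -- the one-bit extractor from a list-decodable code, and the weak design, exist
        (∃ (t : ℕ) (C : Bits n → Bits t → Bool),
          (t : ℝ) ≤ a * Real.logb 2 (n / δ) ∧
          IsListDecodable C (δ / 2) (1 / (δ / 2) ^ 2) ∧
          IsStrongExtractor (3 * Real.logb 2 (1 / δ)) δ C ∧
          ∃ S : Fin m → Finset (Fin (seedLength t m)), IsWeakDesign t 1 S) ∧
        -- every such choice gives a quantum-proof extractor with a short seed
        (∀ (t : ℕ) (C : Bits n → Bits t → Bool),
          (t : ℝ) ≤ a * Real.logb 2 (n / δ) →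
          IsStrongExtractor (3 * Real.logb 2 (1 / δ)) δ C →
          (∀ (S : Fin m → Finset (Fin (seedLength t m))) (hS : IsWeakDesign t 1 S),
            IsQuantumProofStrongExtractor
              (m + 8 * Real.logb 2 m + 8 * Real.logb 2 (1 / ε) + K) ε
              (trevisan C S hS.card_eq)) ∧
          (2 ≤ m → (seedLength t m : ℝ) ≤ c * (t : ℝ) ^ 2 * Real.logb 2 m) ∧
          (2 ≤ m → m ≤ n →
            (seedLength t m : ℝ) ≤ c * Real.logb 2 (n / ε) ^ 2 * Real.logb 2 m)) := by
  have hlog : 0 < Real.log 2 := Real.log_pos one_lt_two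
  have h9 : 0 < Real.logb 2 9 := Real.logb_pos one_lt_two (by norm_num)
  set b : ℝ := 4 * (1 / Real.log 2 + 1) with hb
  have hb0 : 0 < b := by positivity
  -- The required entropy is `m + 4 log (1 / δ)`, whose constant part is `4 log 9`; the extra 1
  -- makes the inequality strict, so that attainment of the supremum in `condMinEntropy` is not
  -- needed. And `56 = 8 * 7` combines the bound on `t` with `logb_div_le`.
  refine ⟨8, 4 * Real.logb 2 9 + 1, b * 56 ^ 2, by norm_num, by positivity, by positivity, ?_⟩
  intro n m ε δ hn hm hε0 hε1 hδ
  have hm' : (1 : ℝ) ≤ m := by exact_mod_cast hm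
  have hδ0 : 0 < δ := by rw [hδ]; positivity
  have hδ9 : δ ≤ 1 / 9 := by
    rw [hδ, div_le_div_iff₀ (by positivity) (by norm_num)]
    have h1 : ε ^ 2 ≤ 1 := pow_le_one₀ hε0.le hε1
    have h2 : 1 ≤ (m : ℝ) ^ 2 := one_le_pow₀ hm'
    linarith
  refine ⟨?_, fun t C ht hC => ⟨fun S hS => ?_, fun hm2 => ?_, fun hm2 hmn => ?_⟩⟩
  · obtain ⟨t, C, h1, h2, h3⟩ := exists_listDecodable_strongExtractor hn hδ0 hδ9
    exact ⟨t, C, h1, h2, h3, exists_isWeakDesign t hm⟩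
  · have hl1 := (one_le_logb_div hn hδ0 hδ9).1
    have hlogδ : Real.logb 2 (1 / δ)
        = Real.logb 2 9 + 2 * Real.logb 2 m + 2 * Real.logb 2 (1 / ε) := by
      rw [hδ, one_div_div, logb_div_eq (by positivity) (by positivity),
        Real.logb_mul (by norm_num) (by positivity), one_div, one_div, ← inv_pow,
        Real.logb_pow, Real.logb_pow]
      push_cast
      ring
    have hsqrt : √δ = ε / (3 * m) := by
      rw [hδ, show ε ^ 2 / (9 * (m : ℝ) ^ 2) = (ε / (3 * m)) ^ 2 by rw [div_pow]; ring]
      exact Real.sqrt_sq (by positivity)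
    refine hC.isQuantumProof_trevisan hδ0 hS (by linarith) (by linarith) ?_
    rw [hsqrt]
    have : (m : ℝ) * (5 / 4 * (ε / (3 * m))) = 5 / 12 * ε := by field_simp; norm_num
    linarith
  · have hlm : 0 ≤ Real.logb 2 m := Real.logb_nonneg one_lt_two hm'
    calc _ ≤ b * (t : ℝ) ^ 2 * Real.logb 2 m := seedLength_le t hm2
      _ ≤ _ := by gcongr; linarith
  · have hlm : 0 ≤ Real.logb 2 m := Real.logb_nonneg one_lt_two hm'
    have ht' : (t : ℝ) ≤ 56 * Real.logb 2 (n / ε) := by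
      have := logb_div_le hm2 hmn hε0 hε1
      rw [← hδ] at this
      linarith
    calc _ ≤ b * (t : ℝ) ^ 2 * Real.logb 2 m := seedLength_le t hm2
      _ ≤ b * (56 * Real.logb 2 (n / ε)) ^ 2 * Real.logb 2 m := by gcongr
      _ = _ := by ring
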